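/- Let $X=\{X(h):h\in\mathfrak H\}$ be an isonormal Gaussian process over a real separable Hilbert space $\mathfrak H$, let $D$ be the Malliavin derivative (the $L^2$-closure of the derivative on smooth functionals of $X$, with domain $\mathbb D^{1,2}$), and let $L^{-1}F=-\sum_{p\ge1}\frac1p J_pF$, where $J_p$ is the orthogonal projection of $L^2(\Omega)$ onto the $p$-th Wiener chaos. The iterated Gamma operators are $\Gamma_0(F)=F$ and $\Gamma_{i+1}(F)=\langle D\Gamma_i(F),-DL^{-1}F\rangle_{\mathfrak H}$. For $\nu>0$ let $G(\nu)$ have the centered Gamma law, i.e. $G(\nu)=2\widehat G(\nu/2)-\nu$, where $\widehat G(\nu/2)$ has density $x^{\nu/2-1}e^{-x}/\Gamma(\nu/2)$ on $(0,\infty)$. Let $\nu>0$ and let $F=I_2(f)$, $f\in\mathfrak H^{\odot2}$, be an element of the second Wiener chaos of $X$ (a double Wiener–Itô integral) with $\mathbb E[F^2]=2\nu$. Then $L^{-1}F$ and all $\Gamma_r(F)$, $r\ge0$, belong to $\mathbb D^{1,2}$ (in particular they are square integrable), so that $$\Delta_r(F):=\operatorname{Var}\bigl(\Gamma_{r+1}(F)-2\Gamma_r(F)\bigr),\qquad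 r\ge 0,$$ is well defined, and the following hold. 1. $F\stackrel{\text{law}}{=}G(\nu)$ if and only if $\Delta_r(F)=0$ for some integer $r\ge0$; and if $F\stackrel{\text{law}}{=}G(\nu)$, then $\Delta_r(F)=0$ for every $r\ge0$. 2. For every $r\ge0$, $\Delta_{r+1}(F)\le 4\nu\,\Delta_r(F)$. Thus, up to constants depending only on $\nu$ (and on the indices), $\cdots\le\Delta_{r+1}(F)\le\Delta_r(F)\le\cdots\le\Delta_0(F)=\operatorname{Var}(\Gamma_1(F)-2F)$. -/

import Mathlib

open MeasureTheory ProbabilityTheory Filter Topology TensorProduct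

noncomputable section

namespace WienerGamma

variable {Ω H : Type*} [MeasurableSpace Ω]
  [NormedAddCommGroup H] [InnerProductSpace ℝ H]

/-- An isonormal Gaussian process over the Hilbert space `H`: a centered, jointly Gaussian family
`X = {X(h) : h ∈ H}` with `E[X(g) X(h)] = ⟪g, h⟫`. -/
structure IsIsonormal (X : H → Ω → ℝ) (P : Measure Ω) : Prop where
  gaussian : IsGaussianProcess X P
  centered : ∀ h, ∫ ω, X h ω ∂P = 0
  covariance : ∀ g h, ∫ ω, X g ω * X h ω ∂P = inner ℝ g h

/-- The `q`-th Wiener chaos of `X`: the closed linear subspace of `L²(Ω)` generated by the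
random variables `H_q(X(h))`, `‖h‖ = 1`, where `H_q` is the (probabilists') Hermite polynomial. -/
def wienerChaos (X : H → Ω → ℝ) (P : Measure Ω) (q : ℕ) : Submodule ℝ (Lp ℝ 2 P) :=
  (Submodule.span ℝ
    {Y : Lp ℝ 2 P | ∃ h : H, ‖h‖ = 1 ∧
      Y =ᵐ[P] fun ω => Polynomial.aeval (X h ω) (Polynomial.hermite q)}).topologicalClosure

/-- The Hilbert space tensor square `H ⊗ H` (completed algebraic tensor product). -/
abbrev HilbertTensorSq (H : Type*) [NormedAddCommGroup H] [InnerProductSpace ℝ H] : Type _ :=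
  UniformSpace.Completion (H ⊗[ℝ] H)

/-- The symmetric tensor square `H ⊙ H`: by polarization, it is the closed linear span of
the elementary tensors `h ⊗ h`. -/
def symTensorSq (H : Type*) [NormedAddCommGroup H] [InnerProductSpace ℝ H] :
    Submodule ℝ (HilbertTensorSq H) :=
  (Submodule.span ℝ
    {t : HilbertTensorSq H | ∃ h : H, t = ((h ⊗ₜ[ℝ] h : H ⊗[ℝ] H) : HilbertTensorSq H)}
    ).topologicalClosure

/-- The graph of the double Wiener-Itô integral `I₂ : H ⊙ H → L²(Ω)`, i.e. of the continuous linear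
map determined by `I₂(h ⊗ h) = H₂(X(h))` for `‖h‖ = 1`. -/
def doubleIntegralGraph (X : H → Ω → ℝ) (P : Measure Ω) :
    Submodule ℝ (HilbertTensorSq H × Lp ℝ 2 P) :=
  (Submodule.span ℝ
    {z : HilbertTensorSq H × Lp ℝ 2 P | ∃ h : H, ‖h‖ = 1 ∧
      z.1 = ((h ⊗ₜ[ℝ] h : H ⊗[ℝ] H) : HilbertTensorSq H) ∧
      z.2 =ᵐ[P] fun ω => Polynomial.aeval (X h ω) (Polynomial.hermite 2)}).topologicalClosure

/-- The random variable `F` is (a version of) the double Wiener-Itô integral `I₂(f)`. -/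
def IsDoubleIntegral (X : H → Ω → ℝ) (P : Measure Ω) (f : HilbertTensorSq H) (F : Ω → ℝ) : Prop :=
  ∃ hF : MemLp F 2 P, (f, hF.toLp F) ∈ doubleIntegralGraph X P

/-- `G` is a smooth random variable `g(X(φ₁), …, X(φₙ))`, where `g` is `C^∞` and, with all its
partial derivatives, of at most polynomial growth, and
`U = ∑ᵢ ∂ᵢg(X(φ₁), …, X(φₙ)) φᵢ` is its Malliavin derivative. -/
def IsSmoothPair (X : H → Ω → ℝ) (G : Ω → ℝ) (U : Ω → H) : Prop :=
  ∃ (n : ℕ) (φ : Fin n → H) (g : (Fin n → ℝ) → ℝ), Function.HasTemperateGrowth g ∧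
    (G = fun ω => g (fun j => X (φ j) ω)) ∧
    (U = fun ω => ∑ i, (fderiv ℝ g (fun j => X (φ j) ω) (Pi.single i 1)) • φ i)

/-- `F ∈ 𝔻^{1,2}` with Malliavin derivative `DF = U`: the pair `(F, U)` is a limit in
`L²(Ω) × L²(Ω; H)` of pairs `(G, DG)` with `G` a smooth random variable. -/
def IsMalliavinDerivative (X : H → Ω → ℝ) (P : Measure Ω) (F : Ω → ℝ) (U : Ω → H) : Prop :=
  MemLp F 2 P ∧ MemLp U 2 P ∧
    ∃ (G : ℕ → Ω → ℝ) (V : ℕ → Ω → H), (∀ n, IsSmoothPair X (G n) (V n)) ∧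
      Tendsto (fun n => eLpNorm (F - G n) 2 P) atTop (𝓝 0) ∧
      Tendsto (fun n => eLpNorm (U - V n) 2 P) atTop (𝓝 0)

/-- The domain `𝔻^{1,2}` of the Malliavin derivative. -/
def MemD12 (X : H → Ω → ℝ) (P : Measure Ω) (F : Ω → ℝ) : Prop :=
  ∃ U : Ω → H, IsMalliavinDerivative X P F U

open Classical in
/-- The Malliavin derivative `DF` of `F ∈ 𝔻^{1,2}` (unique up to null sets, since the derivative
on smooth random variables is closable); `0` outside the domain. -/
def malliavinD (X : H → Ω → ℝ) (P : Measure Ω) (F : Ω → ℝ) : Ω → H :=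
  if h : MemD12 X P F then h.choose else 0

/-- The orthogonal projection `J_q` of `L²(Ω)` onto the `q`-th Wiener chaos; thus `J_q F = I_q(f_q)`
in the chaotic expansion of `F`. -/
def chaosProj (X : H → Ω → ℝ) (P : Measure Ω) (q : ℕ) : Lp ℝ 2 P →L[ℝ] Lp ℝ 2 P :=
  haveI : CompleteSpace (wienerChaos X P q) :=
    (Submodule.isClosed_topologicalClosure _).completeSpace_coe
  (wienerChaos X P q).starProjection

open Classical in
/-- The pseudo-inverse `L⁻¹F = - ∑_{p ≥ 1} (1/p) J_p F` of the generator of the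
Ornstein-Uhlenbeck semigroup, for `F ∈ L²(Ω)`. -/
def pseudoInverse (X : H → Ω → ℝ) (P : Measure Ω) (F : Ω → ℝ) : Ω → ℝ :=
  if h : MemLp F 2 P then
    ((-∑' p : ℕ, (1 / ((p : ℝ) + 1)) • chaosProj X P (p + 1) (h.toLp F) : Lp ℝ 2 P) : Ω → ℝ)
  else 0

/-- The iterated Gamma operators: `Γ₀(F) = F` and `Γ_{i+1}(F) = ⟪DΓ_i(F), -DL⁻¹F⟫`. -/
def gammaOp (X : H → Ω → ℝ) (P : Measure Ω) (F : Ω → ℝ) : ℕ → Ω → ℝ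
  | 0 => F
  | i + 1 => fun ω =>
      inner ℝ (malliavinD X P (gammaOp X P F i) ω) (-(malliavinD X P (pseudoInverse X P F) ω))

/-- `Δ_r(F) = Var(Γ_{r+1}(F) - 2 Γ_r(F))`. -/
def gammaDelta (X : H → Ω → ℝ) (P : Measure Ω) (F : Ω → ℝ) (r : ℕ) : ℝ :=
  variance (fun ω => gammaOp X P F (r + 1) ω - 2 * gammaOp X P F r ω) P

/-- The centered Gamma distribution: the law of `G(ν) = 2 Ĝ(ν/2) - ν`, where `Ĝ(ν/2)` has the
standard Gamma distribution with shape `ν/2` and rate `1`. -/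
def centeredGamma (ν : ℝ) : Measure ℝ :=
  (gammaMeasure (ν / 2) 1).map (fun x => 2 * x - ν)

end WienerGamma

end

/-!
An element `f` of the symmetric tensor square is a self-adjoint Hilbert–Schmidt operator, so it has
a diagonalization `f = ∑ c_j e_j ⊗ e_j` along an orthonormal family
(`WienerGamma.exists_diagonalization`), and then `F = I₂(f) = ∑ c_j (X(e_j)² - 1)` in `L²`
(`WienerGamma.IsDoubleIntegral.isQuadratic`), where the `X(e_j)` are independent standard Gaussian
variables. Everything in the theorem becomes a statement on the eigenvalues `c_j`, which satisfy
`∑ c_j² = ν`.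

* *The Gamma operators.* `F` lies in the second chaos, so `L⁻¹F = -F/2`
  (`WienerGamma.pseudoInverse_doubleIntegral`) and `-DL⁻¹F = ∑ c_j X(e_j) e_j`. Since
  `D ∑ d_j (X(e_j)² - 1) = ∑ 2 d_j X(e_j) e_j`, each application of the Gamma operator multiplies
  the coefficients by `2 c_j`: up to an additive constant, `Γ_r(F) = ∑ 2^r c_j^{r+1} (X(e_j)² - 1)`
  (`WienerGamma.exists_isQuadratic_gammaOp`). Hence
  `Δ_r(F) = 2 ∑ (2^{r+1} c_j^{r+1} (c_j - 1))²` (`WienerGamma.hasSum_gammaDelta`). That this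
  computes the Malliavin derivative, which is only specified as some `L²` limit of derivatives of
  smooth variables, uses closability (`WienerGamma.IsMalliavinDerivative.unique`), a consequence
  of Gaussian integration by parts. As `c_j² ≤ ν`, the bound `Δ_{r+1} ≤ 4ν Δ_r` holds term by term,
  and for every `r`, `Δ_r(F) = 0` exactly when all `c_j` are `0` or `1`.

* *The law.* `𝔼[(F - 3)⁴] = 12ν² + 60ν + 81 + 48 ∑ c_j² (c_j - 1)²`
  (`WienerGamma.IsQuadratic.hasSum_fourth_moment`; equivalently, this combination of
  moments is `𝔼[F⁴] - 12 𝔼[F³]` up to a function of `ν`). The centered Gamma law gives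
  `12ν² + 60ν + 81`, so if `F` has that law, every `c_j` is `0` or `1`. Conversely, if all `c_j` are
  `0` or `1`, only finitely many are nonzero, their number is `ν`, and `F` is a sum of `ν`
  independent centered squares; its characteristic function is that of the centered Gamma law
  (`WienerGamma.hasLaw_sum_centeredSq`).
-/

namespace WienerGamma

/-! ### Functions of temperate growth of Gaussian vectors -/

section Temperate

variable {Ω E F : Type*} [MeasurableSpace Ω] {P : Measure Ω}
  [NormedAddCommGroup E] [NormedSpace ℝ E] [NormedAddCommGroup F] [NormedSpace ℝ F]

lemma hasTemperateGrowth_fderiv {g : E → F} (hg : Function.HasTemperateGrowth g) :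
    Function.HasTemperateGrowth (fderiv ℝ g) := by
  refine ⟨hg.1.fderiv_right (by simp), fun n => ?_⟩
  obtain ⟨k, C, h⟩ := hg.2 (n + 1)
  exact ⟨k, C, fun x => by rw [norm_iteratedFDeriv_fderiv]; exact h x⟩

lemma hasTemperateGrowth_polynomial {g : E → ℝ} (hg : Function.HasTemperateGrowth g)
    (p : Polynomial ℝ) : Function.HasTemperateGrowth (fun x => p.eval (g x)) := by
  simp only [Polynomial.eval_eq_sum_range]
  fun_prop

/-- A function of temperate growth of a Gaussian vector has moments of all orders, since the
vector itself does. -/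
lemma memLp_of_hasTemperateGrowth [CompleteSpace E] [SecondCountableTopology E]
    [MeasurableSpace E] [BorelSpace E] {Y : Ω → E} (hY : HasGaussianLaw Y P) {g : E → F}
    (hg : Function.HasTemperateGrowth g) {p : ENNReal} (hp : p ≠ ⊤) :
    MemLp (fun ω => g (Y ω)) p P := by
  have := hY.isProbabilityMeasure
  have key : ∀ (k : ℕ) (q : ENNReal), q ≠ ⊤ → MemLp (fun ω => (1 + ‖Y ω‖) ^ k) q P := by
    intro k
    induction k with
    | zero => intro q _; simpa using memLp_const (1 : ℝ)
    | succ k ih =>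
      intro q hq
      have h2 : q * 2 ≠ ⊤ := ENNReal.mul_ne_top hq (by simp)
      have ht : ENNReal.HolderTriple (q * 2) (q * 2) q := by
        constructor
        rw [ENNReal.mul_inv (by simp) (by simp), ← mul_add, ENNReal.inv_two_add_inv_two, mul_one]
      simp_rw [pow_succ]
      exact MemLp.mul' (((memLp_const (1 : ℝ)).add (hY.memLp h2).norm)) (ih _ h2) (hpqr := ht)
  obtain ⟨k, C, h⟩ := hg.2 0
  refine ((key k p hp).const_mul C).mono
    (hg.1.continuous.comp_aestronglyMeasurable hY.aemeasurable.aestronglyMeasurable) ?_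
  refine ae_of_all _ fun ω => ?_
  have := h (Y ω)
  rw [norm_iteratedFDeriv_zero] at this
  exact this.trans (le_abs_self _)

end Temperate

/-! ### Gaussian integration by parts -/

/-- Gaussian integration by parts on the line: `E[ξ u(ξ)] = E[u'(ξ)]` for `ξ` standard normal. -/
lemma integral_id_mul_gaussianReal {u : ℝ → ℝ} (hu : Function.HasTemperateGrowth u) :
    ∫ x, x * u x ∂(gaussianReal 0 1) = ∫ x, deriv u x ∂(gaussianReal 0 1) := by
  have hid : HasGaussianLaw (id : ℝ → ℝ) (gaussianReal 0 1) := IsGaussian.hasGaussianLaw_id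
  have hint : ∀ {v : ℝ → ℝ}, Function.HasTemperateGrowth v →
      Integrable (fun x => gaussianPDFReal 0 1 x * v x) := by
    intro v hv
    have h := memLp_one_iff_integrable.1 (memLp_of_hasTemperateGrowth hid hv (p := 1) (by simp))
    rw [gaussianReal_of_var_ne_zero _ one_ne_zero] at h
    rw [gaussianPDF_def, integrable_withDensity_iff_integrable_smul₀'] at h
    · refine h.congr (ae_of_all _ fun x => ?_)
      simp [ENNReal.toReal_ofReal, gaussianPDFReal_nonneg]
    · exact (measurable_gaussianPDFReal 0 1).ennreal_ofReal.aemeasurable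
    · exact ae_of_all _ fun x => by simp
  have hd : ∀ x, HasDerivAt (gaussianPDFReal 0 1) (-x * gaussianPDFReal 0 1 x) x := by
    intro x
    have h1 : HasDerivAt (fun x : ℝ => -(x - 0) ^ 2 / (2 * (1 : NNReal) : ℝ)) (-x) x := by
      have := (((hasDerivAt_id x).sub_const 0).pow 2).neg.div_const (2 * ((1 : NNReal) : ℝ))
      convert! this using 1
      simp; ring
    have := h1.exp.const_mul ((√(2 * Real.pi * (1 : NNReal)))⁻¹)
    rw [gaussianPDFReal_def]
    convert! this using 1
    ring
  have hud : Function.HasTemperateGrowth (deriv u) := by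
    have := hasTemperateGrowth_fderiv hu
    have h2 : deriv u = fun x => ContinuousLinearMap.apply ℝ ℝ (1 : ℝ) (fderiv ℝ u x) := by
      ext x; simp
    rw [h2]
    exact (ContinuousLinearMap.hasTemperateGrowth _).comp this
  have hdu : ∀ x, HasDerivAt u (deriv u x) x := fun x =>
    (hu.1.differentiable (by simp) x).hasDerivAt
  rw [integral_gaussianReal_eq_integral_smul one_ne_zero,
    integral_gaussianReal_eq_integral_smul one_ne_zero]
  have hxu : Function.HasTemperateGrowth (fun x => x * u x) := by fun_prop
  have := integral_mul_deriv_eq_deriv_mul_of_integrable (u := u) (v := gaussianPDFReal 0 1)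
    (fun x _ => hdu x) (fun x _ => hd x) ?_ ?_ ?_
  · simp only [smul_eq_mul]
    calc _ = - ∫ x, u x * (-x * gaussianPDFReal 0 1 x) := by
          rw [← integral_neg]; congr 1; ext x; ring
      _ = _ := by rw [this, neg_neg]; congr 1; ext x; ring
  · refine (hint hxu).neg.congr (ae_of_all _ fun x => ?_)
    simp only [Pi.neg_apply, Pi.mul_apply]; ring
  · refine (hint hud).congr (ae_of_all _ fun x => ?_)
    simp only [Pi.mul_apply]; ring
  · refine (hint hu).congr (ae_of_all _ fun x => ?_)
    simp only [Pi.mul_apply]; ring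

namespace IsIsonormal

variable {Ω H : Type*} [MeasurableSpace Ω] [NormedAddCommGroup H] [InnerProductSpace ℝ H]
  {P : Measure Ω} {X : H → Ω → ℝ} {ι : Type*} [Fintype ι]

lemma hasGaussianLaw_pi (hX : IsIsonormal X P) (φ : ι → H) :
    HasGaussianLaw (fun ω i => X (φ i) ω) P := by
  classical
  let L : (Finset.univ.image φ → ℝ) →L[ℝ] ι → ℝ :=
    { toFun x i := x ⟨φ i, by simp⟩
      map_add' x y := by ext; simp
      map_smul' m x := by ext; simp }
  exact (hX.gaussian.hasGaussianLaw _).map L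

lemma memLp (hX : IsIsonormal X P) (φ : ι → H) {E : Type*} [NormedAddCommGroup E]
    [NormedSpace ℝ E] {g : (ι → ℝ) → E} (hg : Function.HasTemperateGrowth g)
    {p : ENNReal} (hp : p ≠ ⊤) : MemLp (fun ω => g (fun i => X (φ i) ω)) p P :=
  memLp_of_hasTemperateGrowth (hX.hasGaussianLaw_pi φ) hg hp

lemma memLp_apply (hX : IsIsonormal X P) (h : H) {p : ENNReal} (hp : p ≠ ⊤) :
    MemLp (X h) p P := (hX.gaussian.hasGaussianLaw_eval h).memLp hp

lemma covariance_eq (hX : IsIsonormal X P) (g h : H) : cov[X g, X h; P] = inner ℝ g h := by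
  have := hX.gaussian.isProbabilityMeasure
  rw [covariance_eq_sub (hX.memLp_apply g (by simp)) (hX.memLp_apply h (by simp)),
    hX.centered g, hX.centered h, ← hX.covariance g h]
  simp

lemma map_eq_gaussianReal (hX : IsIsonormal X P) {h : H} (hh : ‖h‖ = 1) :
    P.map (X h) = gaussianReal 0 1 := by
  have := hX.gaussian.isProbabilityMeasure
  rw [(hX.gaussian.hasGaussianLaw_eval h).map_eq_gaussianReal, hX.centered h,
    ← covariance_self (hX.gaussian.aemeasurable h), hX.covariance_eq,
    real_inner_self_eq_norm_sq, hh]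
  simp

/-- Integration by parts for an isonormal process. The vector `X(φ)` is decomposed into
`⟪φ, h⟫ X(h)` and a part independent of `X(h)`; the one-dimensional formula is applied to the
first variable. -/
lemma integral_mul_eq_integral_fderiv (hX : IsIsonormal X P) {h : H} (hh : ‖h‖ = 1)
    (φ : ι → H) {g : (ι → ℝ) → ℝ} (hg : Function.HasTemperateGrowth g) :
    ∫ ω, X h ω * g (fun i => X (φ i) ω) ∂P =
      ∫ ω, fderiv ℝ g (fun i => X (φ i) ω) (fun i => inner ℝ (φ i) h) ∂P := by
  have := hX.gaussian.isProbabilityMeasure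
  set a : ι → ℝ := fun i => inner ℝ (φ i) h with ha
  let Z : ι → Ω → ℝ := fun i ω => X (φ i) ω - a i * X h ω
  have hjoint : HasGaussianLaw (fun ω => (fun _ : Unit => X h ω, fun i => Z i ω)) P := by
    have h1 := hX.hasGaussianLaw_pi (fun o : Option ι => o.elim h φ)
    let L : (Option ι → ℝ) →L[ℝ] (Unit → ℝ) × (ι → ℝ) :=
      { toFun x := (fun _ => x none, fun i => x (some i) - a i * x none)
        map_add' x y := by ext <;> simp; ring
        map_smul' m x := by ext <;> simp; ring }
    exact h1.map L
  have hind : IndepFun (fun ω (_ : Unit) => X h ω) (fun ω i => Z i ω) P := by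
    refine HasGaussianLaw.indepFun_of_covariance_eval (X := fun _ => X h) hjoint fun _ i => ?_
    have h2 := hX.memLp_apply h (p := 2) (by simp)
    have h3 := hX.memLp_apply (φ i) (p := 2) (by simp)
    change cov[X h, fun ω => X (φ i) ω - a i * X h ω; P] = 0
    rw [covariance_fun_sub_right h2 h3 (h2.const_mul _), covariance_const_mul_right,
      hX.covariance_eq, hX.covariance_eq, real_inner_self_eq_norm_sq, hh, ha]
    simp [real_inner_comm]
  have hind' : IndepFun (X h) (fun ω i => Z i ω) P :=
    hind.comp (φ := fun f : Unit → ℝ => f ()) (ψ := id) (measurable_pi_apply ()) measurable_id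
  have hXm := hX.gaussian.aemeasurable h
  have hZm : AEMeasurable (fun ω i => Z i ω) P := hjoint.snd.aemeasurable
  have hmap : P.map (fun ω => (X h ω, fun i => Z i ω)) =
      (gaussianReal 0 1).prod (P.map (fun ω i => Z i ω)) := by
    rw [(indepFun_iff_map_prod_eq_prod_map_map hXm hZm).1 hind', hX.map_eq_gaussianReal hh]
  have : IsProbabilityMeasure (P.map (fun ω i => Z i ω)) := Measure.isProbabilityMeasure_map hZm
  have hrec : ∀ ω, (fun i => X (φ i) ω) = (fun i => Z i ω) + X h ω • a := by
    intro ω; ext i; simp [Z, mul_comm]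
  -- Both sides become integrals over the product law of `X(h)` and the independent part.
  have hgd := hasTemperateGrowth_fderiv hg
  have hc1 : Continuous fun q : ℝ × (ι → ℝ) => q.1 * g (q.2 + q.1 • a) := by
    have := hg.1.continuous; fun_prop
  have hc2 : Continuous fun q : ℝ × (ι → ℝ) => fderiv ℝ g (q.2 + q.1 • a) a := by
    have := hgd.1.continuous; fun_prop
  have hi1 : Integrable (fun ω => X h ω * g (fun i => X (φ i) ω)) P :=
    MemLp.integrable_mul (p := 2) (q := 2) (hX.memLp_apply h (by simp)) (hX.memLp φ hg (by simp))
  have hi2 : Integrable (fun ω => fderiv ℝ g (fun i => X (φ i) ω) a) P :=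
    memLp_one_iff_integrable.1 (hX.memLp φ
      (g := fun x => ContinuousLinearMap.apply ℝ ℝ a (fderiv ℝ g x))
      ((ContinuousLinearMap.hasTemperateGrowth _).comp hgd) (by simp))
  have hpm : AEMeasurable (fun ω => (X h ω, fun i => Z i ω)) P := hXm.prodMk hZm
  have e1 : ∫ ω, X h ω * g (fun i => X (φ i) ω) ∂P =
      ∫ q, q.1 * g (q.2 + q.1 • a) ∂((gaussianReal 0 1).prod (P.map (fun ω i => Z i ω))) := by
    rw [← hmap, integral_map hpm hc1.aestronglyMeasurable]
    simp_rw [hrec]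
  have e2 : ∫ ω, fderiv ℝ g (fun i => X (φ i) ω) a ∂P =
      ∫ q, fderiv ℝ g (q.2 + q.1 • a) a
        ∂((gaussianReal 0 1).prod (P.map (fun ω i => Z i ω))) := by
    rw [← hmap, integral_map hpm hc2.aestronglyMeasurable]
    simp_rw [hrec]
  have j1 : Integrable (fun q : ℝ × (ι → ℝ) => q.1 * g (q.2 + q.1 • a))
      ((gaussianReal 0 1).prod (P.map (fun ω i => Z i ω))) := by
    rw [← hmap, integrable_map_measure hc1.aestronglyMeasurable hpm]
    refine hi1.congr (ae_of_all _ fun ω => ?_)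
    simp [Function.comp, hrec]
  have j2 : Integrable (fun q : ℝ × (ι → ℝ) => fderiv ℝ g (q.2 + q.1 • a) a)
      ((gaussianReal 0 1).prod (P.map (fun ω i => Z i ω))) := by
    rw [← hmap, integrable_map_measure hc2.aestronglyMeasurable hpm]
    refine hi2.congr (ae_of_all _ fun ω => ?_)
    simp [Function.comp, hrec]
  rw [e1, e2, integral_prod_symm _ j1, integral_prod_symm _ j2]
  refine integral_congr_ae (ae_of_all _ fun z => ?_)
  have hu : Function.HasTemperateGrowth (fun x : ℝ => g (z + x • a)) := by
    refine hg.comp (f := fun x : ℝ => z + x • a) ?_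
    fun_prop
  simp only
  rw [integral_id_mul_gaussianReal hu]
  congr 1
  ext x
  have h1 : HasDerivAt (fun x : ℝ => z + x • a) a x := by
    simpa using ((hasDerivAt_id x).smul_const a).const_add z
  exact ((hg.1.differentiable (by simp) (z + x • a)).hasFDerivAt.comp_hasDerivAt x h1).deriv

end IsIsonormal

/-! ### Closability of the Malliavin derivative -/

section Pairing

variable {Ω H β : Type*} [MeasurableSpace Ω] [NormedAddCommGroup H] [InnerProductSpace ℝ H]
  {P : Measure Ω}

lemma memLp_one_inner {U W : Ω → H} (hU : MemLp U 2 P) (hW : MemLp W 2 P) :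
    MemLp (fun ω => inner ℝ (U ω) (W ω)) 1 P :=
  MemLp.of_bilin (p := 2) (q := 2) (fun x y => inner ℝ x y) 1 hU hW (hU.1.inner hW.1)
    (ae_of_all _ fun ω => by
      rw [one_mul]; exact norm_inner_le_norm (𝕜 := ℝ) (U ω) (W ω))

lemma eLpNorm_one_inner_le {U W : Ω → H} (hU : AEStronglyMeasurable U P)
    (hW : AEStronglyMeasurable W P) :
    eLpNorm (fun ω => inner ℝ (U ω) (W ω)) 1 P ≤ eLpNorm U 2 P * eLpNorm W 2 P := by
  simpa using! eLpNorm_le_eLpNorm_mul_eLpNorm_of_nnnorm (p := 2) (q := 2) (r := 1) hU hW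
    (fun x y => inner ℝ x y) 1
    (ae_of_all _ fun ω => by
      rw [one_mul]; exact norm_inner_le_norm (𝕜 := ℝ) (U ω) (W ω))

/-- The pairing `L² × L² → L¹` of Hilbert space valued random variables is continuous. -/
lemma tendsto_eLpNorm_one_inner {l : Filter β} {U W : Ω → H} {Un Wn : β → Ω → H}
    (hU : MemLp U 2 P) (hW : MemLp W 2 P) (hUn : ∀ n, MemLp (Un n) 2 P)
    (hWn : ∀ n, MemLp (Wn n) 2 P)
    (h1 : Tendsto (fun n => eLpNorm (U - Un n) 2 P) l (𝓝 0))
    (h2 : Tendsto (fun n => eLpNorm (W - Wn n) 2 P) l (𝓝 0)) :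
    Tendsto (fun n => eLpNorm ((fun ω => inner ℝ (U ω) (W ω)) -
      (fun ω => inner ℝ (Un n ω) (Wn n ω))) 1 P) l (𝓝 0) := by
  have hlim : Tendsto (fun n => eLpNorm (U - Un n) 2 P * eLpNorm W 2 P +
      eLpNorm U 2 P * eLpNorm (W - Wn n) 2 P +
      eLpNorm (U - Un n) 2 P * eLpNorm (W - Wn n) 2 P) l (𝓝 0) := by
    have a := ENNReal.Tendsto.mul_const (b := eLpNorm W 2 P) h1 (Or.inr hW.2.ne)
    have b := ENNReal.Tendsto.const_mul (a := eLpNorm U 2 P) h2 (Or.inr hU.2.ne)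
    have c := ENNReal.Tendsto.mul h1 (Or.inr ENNReal.zero_ne_top) h2 (Or.inr ENNReal.zero_ne_top)
    simpa using (a.add b).add c
  refine tendsto_of_tendsto_of_tendsto_of_le_of_le tendsto_const_nhds hlim
    (fun _ => zero_le) fun n => ?_
  have hA := memLp_one_inner (hU.sub (hUn n)) hW
  have hB := memLp_one_inner hU (hW.sub (hWn n))
  have hC := memLp_one_inner (hU.sub (hUn n)) (hW.sub (hWn n))
  have heq : (fun ω => inner ℝ (U ω) (W ω)) - (fun ω => inner ℝ (Un n ω) (Wn n ω)) =
      (fun ω => inner ℝ ((U - Un n) ω) (W ω)) + (fun ω => inner ℝ (U ω) ((W - Wn n) ω)) -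
        (fun ω => inner ℝ ((U - Un n) ω) ((W - Wn n) ω)) := by
    ext ω
    simp only [Pi.sub_apply, Pi.add_apply, inner_sub_left, inner_sub_right]
    ring
  simp only [heq]
  refine (eLpNorm_sub_le (hA.add hB).1 hC.1 le_rfl).trans (add_le_add ?_ ?_)
  · exact (eLpNorm_add_le hA.1 hB.1 le_rfl).trans (add_le_add
      (eLpNorm_one_inner_le (hU.sub (hUn n)).1 hW.1) (eLpNorm_one_inner_le hU.1 (hW.sub (hWn n)).1))
  · exact eLpNorm_one_inner_le (hU.sub (hUn n)).1 (hW.sub (hWn n)).1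

lemma tendsto_integral_inner {l : Filter β} {U W : Ω → H} {Un Wn : β → Ω → H}
    (hU : MemLp U 2 P) (hW : MemLp W 2 P) (hUn : ∀ n, MemLp (Un n) 2 P)
    (hWn : ∀ n, MemLp (Wn n) 2 P)
    (h1 : Tendsto (fun n => eLpNorm (U - Un n) 2 P) l (𝓝 0))
    (h2 : Tendsto (fun n => eLpNorm (W - Wn n) 2 P) l (𝓝 0)) :
    Tendsto (fun n => ∫ ω, inner ℝ (Un n ω) (Wn n ω) ∂P) l
      (𝓝 (∫ ω, inner ℝ (U ω) (W ω) ∂P)) := by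
  refine tendsto_integral_of_L1' (fun ω => inner ℝ (U ω) (W ω))
    (memLp_one_inner hU hW).1 ?_ ?_
  · exact .of_forall fun n => memLp_one_iff_integrable.1 (memLp_one_inner (hUn n) (hWn n))
  · refine (tendsto_eLpNorm_one_inner hU hW hUn hWn h1 h2).congr fun n => ?_
    rw [eLpNorm_sub_comm]

end Pairing

section Smooth

variable {Ω H : Type*} [MeasurableSpace Ω] [NormedAddCommGroup H] [InnerProductSpace ℝ H]
  {P : Measure Ω} {X : H → Ω → ℝ} {G K : Ω → ℝ} {V W : Ω → H}

omit [MeasurableSpace Ω] in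
/-- A smooth random variable may be rewritten as a function of any larger family of Gaussian
variables, without changing its derivative. -/
lemma IsSmoothPair.reindex {n N : ℕ} {φ : Fin n → H} {χ : Fin N → H} (σ : Fin n → Fin N)
    (hσ : ∀ i, χ (σ i) = φ i) {g : (Fin n → ℝ) → ℝ} (hg : Function.HasTemperateGrowth g) :
    ∃ g' : (Fin N → ℝ) → ℝ, Function.HasTemperateGrowth g' ∧
      (∀ ω, g (fun j => X (φ j) ω) = g' (fun j => X (χ j) ω)) ∧
      ∀ ω, ∑ i, (fderiv ℝ g (fun j => X (φ j) ω) (Pi.single i 1)) • φ i =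
        ∑ i, (fderiv ℝ g' (fun j => X (χ j) ω) (Pi.single i 1)) • χ i := by
  let L : (Fin N → ℝ) →L[ℝ] (Fin n → ℝ) := ContinuousLinearMap.pi fun i => .proj (σ i)
  have hL : ∀ ω, L (fun j => X (χ j) ω) = fun j => X (φ j) ω := by
    intro ω; ext i; simp [L, hσ]
  refine ⟨fun x => g (L x), hg.comp L.hasTemperateGrowth, fun ω => by simp only [hL], fun ω => ?_⟩
  have hd : fderiv ℝ (fun x => g (L x)) (fun j => X (χ j) ω) =
      (fderiv ℝ g (fun j => X (φ j) ω)).comp L := by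
    have := ((hg.1.differentiable (by simp) (L (fun j => X (χ j) ω))).hasFDerivAt.comp
      (fun j => X (χ j) ω) L.hasFDerivAt).fderiv
    rw [hL] at this
    exact this
  have hs : ∀ j : Fin N, L (Pi.single j 1) =
      ∑ i, (if σ i = j then (1 : ℝ) else 0) • Pi.single (M := fun _ => ℝ) i 1 := by
    intro j; ext k
    simp only [L, Finset.sum_apply, Pi.smul_apply, Pi.single_apply, smul_eq_mul,
      ContinuousLinearMap.pi_apply, ContinuousLinearMap.proj_apply]
    rw [Finset.sum_eq_single k (fun b _ hb => by simp [hb.symm]) (by simp)]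
    simp
  simp_rw [hd, ContinuousLinearMap.comp_apply, hs, map_sum, map_smul, Finset.sum_smul]
  rw [Finset.sum_comm]
  refine Finset.sum_congr rfl fun i _ => ?_
  simp [← hσ]

omit [MeasurableSpace Ω] in
/-- Two smooth random variables are functions of one common family of Gaussian variables. -/
lemma IsSmoothPair.common (hG : IsSmoothPair X G V) (hK : IsSmoothPair X K W) :
    ∃ (n : ℕ) (φ : Fin n → H) (g k : (Fin n → ℝ) → ℝ), Function.HasTemperateGrowth g ∧
      Function.HasTemperateGrowth k ∧
      (G = fun ω => g (fun j => X (φ j) ω)) ∧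
      (V = fun ω => ∑ i, (fderiv ℝ g (fun j => X (φ j) ω) (Pi.single i 1)) • φ i) ∧
      (K = fun ω => k (fun j => X (φ j) ω)) ∧
      (W = fun ω => ∑ i, (fderiv ℝ k (fun j => X (φ j) ω) (Pi.single i 1)) • φ i) := by
  obtain ⟨n, φ, g, hg, rfl, rfl⟩ := hG
  obtain ⟨m, χ, k, hk, rfl, rfl⟩ := hK
  obtain ⟨g', hg', e1, e2⟩ := IsSmoothPair.reindex (X := X) (φ := φ) (χ := Fin.append φ χ)
    (Fin.castAdd m) (by simp) hg
  obtain ⟨k', hk', e3, e4⟩ := IsSmoothPair.reindex (X := X) (φ := χ) (χ := Fin.append φ χ)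
    (Fin.natAdd n) (by simp) hk
  exact ⟨n + m, Fin.append φ χ, g', k', hg', hk', funext e1, funext e2, funext e3, funext e4⟩

omit [MeasurableSpace Ω] in
lemma IsSmoothPair.sub (hG : IsSmoothPair X G V) (hK : IsSmoothPair X K W) :
    IsSmoothPair X (G - K) (V - W) := by
  obtain ⟨n, φ, g, k, hg, hk, rfl, rfl, rfl, rfl⟩ := hG.common hK
  refine ⟨n, φ, g - k, hg.sub hk, rfl, ?_⟩
  ext ω
  rw [fderiv_sub (hg.1.differentiable (by simp) _) (hk.1.differentiable (by simp) _)]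
  simp [sub_smul, Finset.sum_sub_distrib]

omit [MeasurableSpace Ω] in
lemma IsSmoothPair.mul (hG : IsSmoothPair X G V) (hK : IsSmoothPair X K W) :
    IsSmoothPair X (G * K) (G • W + K • V) := by
  obtain ⟨n, φ, g, k, hg, hk, rfl, rfl, rfl, rfl⟩ := hG.common hK
  refine ⟨n, φ, g * k, hg.mul hk, rfl, ?_⟩
  ext ω
  rw [fderiv_mul (hg.1.differentiable (by simp) _) (hk.1.differentiable (by simp) _)]
  simp [add_smul, Finset.sum_add_distrib, Finset.smul_sum, smul_smul]

omit [MeasurableSpace Ω] in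
/-- A directional derivative of a smooth random variable is again smooth. -/
lemma IsSmoothPair.inner_right (hG : IsSmoothPair X G V) (h : H) :
    ∃ W, IsSmoothPair X (fun ω => inner ℝ (V ω) h) W := by
  obtain ⟨n, φ, g, hg, rfl, rfl⟩ := hG
  have hgd := hasTemperateGrowth_fderiv hg
  refine ⟨_, n, φ, fun x => fderiv ℝ g x (fun i => inner ℝ (φ i) h), ?_, ?_, rfl⟩
  · exact (ContinuousLinearMap.apply ℝ ℝ
      (fun i => inner ℝ (φ i) h : Fin n → ℝ)).hasTemperateGrowth.comp hgd
  · ext ω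
    simp only
    rw [pi_eq_sum_univ' (fun i => inner ℝ (φ i) h), map_sum, sum_inner]
    simp [inner_smul_left, mul_comm]

variable (hX : IsIsonormal X P)
include hX

lemma IsSmoothPair.memLp (hG : IsSmoothPair X G V) {p : ENNReal} (hp : p ≠ ⊤) :
    MemLp G p P := by
  obtain ⟨n, φ, g, hg, rfl, rfl⟩ := hG
  exact hX.memLp φ hg hp

lemma IsSmoothPair.memLp_deriv (hG : IsSmoothPair X G V) {p : ENNReal} (hp : p ≠ ⊤) :
    MemLp V p P := by
  obtain ⟨n, φ, g, hg, rfl, rfl⟩ := hG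
  have hgd := hasTemperateGrowth_fderiv hg
  refine hX.memLp φ (g := fun x => ∑ i, (fderiv ℝ g x (Pi.single i 1)) • φ i) ?_ hp
  have : ∀ i : Fin n, Function.HasTemperateGrowth
      (fun x => fderiv ℝ g x (Pi.single i 1)) := fun i =>
    (ContinuousLinearMap.apply ℝ ℝ
      (Pi.single i 1 : Fin n → ℝ)).hasTemperateGrowth.comp hgd
  fun_prop

lemma IsSmoothPair.integral_inner (hG : IsSmoothPair X G V) {h : H} (hh : ‖h‖ = 1) :
    ∫ ω, inner ℝ (V ω) h ∂P = ∫ ω, X h ω * G ω ∂P := by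
  obtain ⟨n, φ, g, hg, rfl, rfl⟩ := hG
  rw [hX.integral_mul_eq_integral_fderiv hh φ hg]
  congr 1
  ext ω
  rw [pi_eq_sum_univ' (fun i => inner ℝ (φ i) h), map_sum, sum_inner]
  simp [inner_smul_left, mul_comm]

lemma IsSmoothPair.memLp_adjoint (hK : IsSmoothPair X K W) (h : H) :
    MemLp (fun ω => X h ω * K ω - inner ℝ (W ω) h) 2 P := by
  have ht : ENNReal.HolderTriple 4 4 2 := ⟨by
    rw [show (4 : ENNReal) = 2 * 2 by norm_num, ENNReal.mul_inv (by simp) (by simp),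
      ← mul_add, ENNReal.inv_two_add_inv_two, mul_one]⟩
  exact MemLp.sub (MemLp.mul' (p := 4) (q := 4) (hK.memLp hX (by simp))
    (hX.memLp_apply h (by simp))) ((hK.memLp_deriv hX (p := 2) (by simp)).inner_const (𝕜 := ℝ) h)

/-- The adjoint of the derivative in the direction `h`, tested against the smooth variable `K`,
is `X(h) K - ⟪DK, h⟫`. -/
lemma IsSmoothPair.integral_inner_smul (hG : IsSmoothPair X G V) (hK : IsSmoothPair X K W)
    {h : H} (hh : ‖h‖ = 1) :
    ∫ ω, inner ℝ (V ω) (K ω • h) ∂P =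
      ∫ ω, inner ℝ (G ω) (X h ω * K ω - inner ℝ (W ω) h) ∂P := by
  have hGm : MemLp G 2 P := hG.memLp hX (by simp)
  have hKm : MemLp K 2 P := hK.memLp hX (by simp)
  have hWm : MemLp (fun ω => inner ℝ (W ω) h) 2 P :=
    (hK.memLp_deriv hX (p := 2) (by simp)).inner_const (𝕜 := ℝ) h
  have hVm : MemLp (fun ω => inner ℝ (V ω) h) 2 P :=
    (hG.memLp_deriv hX (p := 2) (by simp)).inner_const (𝕜 := ℝ) h
  have hR := hK.memLp_adjoint hX h
  have ibp := (hG.mul hK).integral_inner hX hh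
  have hi1 : Integrable (fun ω => G ω * inner ℝ (W ω) h) P := hGm.integrable_mul hWm
  have hi2 : Integrable (fun ω => K ω * inner ℝ (V ω) h) P := hKm.integrable_mul hVm
  have hi4 : Integrable (fun ω => G ω * (X h ω * K ω - inner ℝ (W ω) h)) P :=
    hGm.integrable_mul hR
  have e1 : ∀ ω, inner ℝ ((G • W + K • V) ω) h =
      G ω * inner ℝ (W ω) h + K ω * inner ℝ (V ω) h := fun ω => by
    simp [inner_add_left, inner_smul_left]
  have e2 : ∀ ω, X h ω * (G * K) ω =
      G ω * (X h ω * K ω - inner ℝ (W ω) h) + G ω * inner ℝ (W ω) h := fun ω => by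
    simp only [Pi.mul_apply]; ring
  simp_rw [e1, e2] at ibp
  rw [integral_add hi1 hi2, integral_add hi4 hi1] at ibp
  have e3 : ∀ ω, inner ℝ (V ω) (K ω • h) = K ω * inner ℝ (V ω) h := fun ω => by
    rw [inner_smul_right]
  have e4 : ∀ ω, inner ℝ (G ω) (X h ω * K ω - inner ℝ (W ω) h) =
      G ω * (X h ω * K ω - inner ℝ (W ω) h) := fun ω => by
    simp only [RCLike.inner_apply, conj_trivial]; ring
  simp_rw [e3, e4]
  linarith

end Smooth

section Closable

variable {Ω H : Type*} [MeasurableSpace Ω] [NormedAddCommGroup H] [InnerProductSpace ℝ H]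
  [TopologicalSpace.SeparableSpace H] {P : Measure Ω} {X : H → Ω → ℝ}

/-- Closability of the derivative on smooth random variables. Testing the limit `V` against its
own smooth approximations reduces the claim `E⟪V, h⟫² = 0` to integration by parts. -/
lemma ae_eq_zero_of_tendsto_smooth (hX : IsIsonormal X P) {G : ℕ → Ω → ℝ} {V : ℕ → Ω → H}
    {U : Ω → H} (hs : ∀ n, IsSmoothPair X (G n) (V n)) (hU : MemLp U 2 P)
    (hG : Tendsto (fun n => eLpNorm (G n) 2 P) atTop (𝓝 0))
    (hV : Tendsto (fun n => eLpNorm (U - V n) 2 P) atTop (𝓝 0)) : U =ᵐ[P] 0 := by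
  have : SecondCountableTopology H := UniformSpace.secondCountable_of_separable H
  have hVm : ∀ n, MemLp (V n) 2 P := fun n => (hs n).memLp_deriv hX (by simp)
  have unit : ∀ h : H, ‖h‖ = 1 → (fun ω => inner ℝ (U ω) h) =ᵐ[P] 0 := by
    intro h hh
    choose W hW using fun n => (hs n).inner_right h
    have hvm : ∀ n, MemLp (fun ω => inner ℝ (V n ω) h • h) 2 P := fun n =>
      MemLp.of_le_mul (c := 1) ((hW n).memLp hX (p := 2) (by simp))
        (((hW n).memLp hX (p := 2) (by simp)).1.smul_const h)
        (ae_of_all _ fun ω => by simp [norm_smul, hh])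
    have huL : MemLp (fun ω => inner ℝ (U ω) h • h) 2 P :=
      MemLp.of_le_mul (c := 1) (hU.inner_const (𝕜 := ℝ) h)
        ((hU.inner_const (𝕜 := ℝ) h).1.smul_const h)
        (ae_of_all _ fun ω => by simp [norm_smul, hh])
    have orth : ∀ m, ∫ ω, inner ℝ (U ω) (inner ℝ (V m ω) h • h) ∂P = 0 := by
      intro m
      have t1 := tendsto_integral_inner hU (hvm m) hVm (fun _ => hvm m) hV (by simp)
      refine tendsto_nhds_unique t1 ?_
      have hR := (hW m).memLp_adjoint hX h
      have hG0 : Tendsto (fun n => eLpNorm ((0 : Ω → ℝ) - G n) 2 P) atTop (𝓝 0) := by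
        simpa only [zero_sub, eLpNorm_neg] using hG
      have t2 := tendsto_integral_inner (U := (0 : Ω → ℝ)) (Un := G)
        (W := fun ω => X h ω * inner ℝ (V m ω) h - inner ℝ (W m ω) h)
        (Wn := fun _ ω => X h ω * inner ℝ (V m ω) h - inner ℝ (W m ω) h) MemLp.zero hR
        (fun n => (hs n).memLp hX (by simp)) (fun _ => hR) hG0 (by simp)
      simp only [Pi.zero_apply, inner_zero_left, integral_zero] at t2
      exact t2.congr fun n => ((hs n).integral_inner_smul hX (hW m) hh).symm
    have hv : Tendsto (fun m => eLpNorm ((fun ω => inner ℝ (U ω) h • h) -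
        (fun ω => inner ℝ (V m ω) h • h)) 2 P) atTop (𝓝 0) := by
      refine tendsto_of_tendsto_of_tendsto_of_le_of_le tendsto_const_nhds hV
        (fun _ => zero_le) fun m => ?_
      refine eLpNorm_mono fun ω => ?_
      simp only [Pi.sub_apply]
      rw [← sub_smul, ← inner_sub_left, norm_smul, hh, mul_one]
      exact (norm_inner_le_norm _ _).trans (by rw [hh, mul_one])
    have t3 := tendsto_integral_inner hU huL (fun _ => hU) hvm (by simp) hv
    simp_rw [orth] at t3
    have h0 : ∫ ω, inner ℝ (U ω) h ^ 2 ∂P = 0 := by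
      rw [tendsto_nhds_unique tendsto_const_nhds t3]
      congr 1
      ext ω
      simp [inner_smul_right, sq]
    have hsq : (fun ω => inner ℝ (U ω) h ^ 2) =ᵐ[P] 0 :=
      (integral_eq_zero_iff_of_nonneg (fun ω => sq_nonneg _)
        (hU.inner_const h).integrable_sq).1 h0
    filter_upwards [hsq] with ω hω
    simpa using hω
  refine ae_eq_zero_of_forall_inner (𝕜 := ℝ) fun c => ?_
  by_cases hc : c = 0
  · simp [hc]; rfl
  · have hu := unit (‖c‖⁻¹ • c) (norm_smul_inv_norm (𝕜 := ℝ) hc)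
    filter_upwards [hu] with ω hω
    simpa [inner_smul_right, hc, real_inner_comm] using hω

/-- The Malliavin derivative is unique up to null sets. -/
lemma IsMalliavinDerivative.unique (hX : IsIsonormal X P) {F F' : Ω → ℝ} {U U' : Ω → H}
    (h : IsMalliavinDerivative X P F U) (h' : IsMalliavinDerivative X P F' U')
    (hF : F =ᵐ[P] F') : U =ᵐ[P] U' := by
  obtain ⟨hFm, hU, G, V, hs, hG, hV⟩ := h
  obtain ⟨hFm', hU', G', V', hs', hG', hV'⟩ := h'
  have hz : U - U' =ᵐ[P] 0 := by
    refine ae_eq_zero_of_tendsto_smooth hX (G := fun n => G n - G' n) (V := fun n => V n - V' n)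
      (fun n => (hs n).sub (hs' n)) (hU.sub hU') ?_ ?_
    · refine tendsto_of_tendsto_of_tendsto_of_le_of_le tendsto_const_nhds
        (by simpa using hG'.add hG) (fun _ => zero_le) fun n => ?_
      have e : (G n - G' n : Ω → ℝ) =ᵐ[P] (F' - G' n) - (F - G n) := by
        filter_upwards [hF] with ω hω
        simp [hω]
      rw [eLpNorm_congr_ae e]
      exact eLpNorm_sub_le (hFm'.sub ((hs' n).memLp hX (by simp))).1
        (hFm.sub ((hs n).memLp hX (by simp))).1 (by norm_num)
    · refine tendsto_of_tendsto_of_tendsto_of_le_of_le tendsto_const_nhds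
        (by simpa using hV.add hV') (fun _ => zero_le) fun n => ?_
      have e : U - U' - (V n - V' n) = (U - V n) - (U' - V' n) := by abel
      simp only [e]
      exact eLpNorm_sub_le (hU.sub ((hs n).memLp_deriv hX (by simp))).1
        (hU'.sub ((hs' n).memLp_deriv hX (by simp))).1 (by norm_num)
  filter_upwards [hz] with ω hω
  exact sub_eq_zero.1 hω

/-- Any pair `(F', U)` in the closed graph computes the derivative of every version `F` of `F'`. -/
lemma IsMalliavinDerivative.malliavinD_ae_eq (hX : IsIsonormal X P) {F F' : Ω → ℝ}
    {U : Ω → H} (h : IsMalliavinDerivative X P F' U) (hF : F =ᵐ[P] F') :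
    MemD12 X P F ∧ malliavinD X P F =ᵐ[P] U := by
  have hmem : MemD12 X P F := by
    obtain ⟨hFm, hU, G, V, hs, hG, hV⟩ := h
    refine ⟨U, hFm.ae_eq hF.symm, hU, G, V, hs, hG.congr fun n => eLpNorm_congr_ae ?_, hV⟩
    filter_upwards [hF] with ω hω
    simp [hω]
  refine ⟨hmem, ?_⟩
  rw [malliavinD, dif_pos hmem]
  exact hmem.choose_spec.unique hX h hF

end Closable

/-! ### Orthogonality of the Wiener chaoses -/

section Chaos

variable {Ω H : Type*} [MeasurableSpace Ω] [NormedAddCommGroup H] [InnerProductSpace ℝ H]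
  {P : Measure Ω} {X : H → Ω → ℝ}

lemma aeval_hermite (q : ℕ) (x : ℝ) :
    Polynomial.aeval x (Polynomial.hermite q) =
      ((Polynomial.hermite q).map (Int.castRingHom ℝ)).eval x := by
  rw [Polynomial.aeval_def, Polynomial.eval_map]; rfl

lemma aeval_hermite_two (x : ℝ) : Polynomial.aeval x (Polynomial.hermite 2) = x ^ 2 - 1 := by
  rw [show (2 : ℕ) = 1 + 1 from rfl, Polynomial.hermite_succ, Polynomial.hermite_one]
  simp [sq]

namespace IsIsonormal

variable (hX : IsIsonormal X P)
include hX

lemma memLp_polynomial (p : Polynomial ℝ) (h : H) {r : ENNReal} (hr : r ≠ ⊤) :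
    MemLp (fun ω => p.eval (X h ω)) r P :=
  hX.memLp (ι := Unit) (fun _ => h) (g := fun x => p.eval (x ()))
    (hasTemperateGrowth_polynomial
      (ContinuousLinearMap.proj (R := ℝ) (φ := fun _ : Unit => ℝ) ()).hasTemperateGrowth p) hr

lemma memLp_hermite (q : ℕ) (h : H) {r : ENNReal} (hr : r ≠ ⊤) :
    MemLp (fun ω => Polynomial.aeval (X h ω) (Polynomial.hermite q)) r P := by
  simp_rw [aeval_hermite]
  exact hX.memLp_polynomial _ h hr

lemma integral_mul_polynomial {h : H} (hh : ‖h‖ = 1) (g : H) (p q : Polynomial ℝ) :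
    ∫ ω, X h ω * (p.eval (X h ω) * q.eval (X g ω)) ∂P =
      ∫ ω, p.derivative.eval (X h ω) * q.eval (X g ω) ∂P +
        inner ℝ g h * ∫ ω, p.eval (X h ω) * q.derivative.eval (X g ω) ∂P := by
  have h0 : Function.HasTemperateGrowth (fun x : Fin 2 → ℝ => x 0) :=
    (ContinuousLinearMap.proj (R := ℝ) (φ := fun _ : Fin 2 => ℝ) 0).hasTemperateGrowth
  have h1 : Function.HasTemperateGrowth (fun x : Fin 2 → ℝ => x 1) :=
    (ContinuousLinearMap.proj (R := ℝ) (φ := fun _ : Fin 2 => ℝ) 1).hasTemperateGrowth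
  have ht : Function.HasTemperateGrowth
      (fun x : Fin 2 → ℝ => p.eval (x 0) * q.eval (x 1)) :=
    (hasTemperateGrowth_polynomial h0 p).mul (hasTemperateGrowth_polynomial h1 q)
  have ibp := hX.integral_mul_eq_integral_fderiv hh ![h, g] ht
  have hd : ∀ x v : Fin 2 → ℝ, fderiv ℝ (fun x : Fin 2 → ℝ => p.eval (x 0) * q.eval (x 1)) x v =
      v 0 * (p.derivative.eval (x 0) * q.eval (x 1)) +
        v 1 * (p.eval (x 0) * q.derivative.eval (x 1)) := by
    intro x v
    have d0 := (p.hasDerivAt (x 0)).comp_hasFDerivAt x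
      (ContinuousLinearMap.proj (R := ℝ) (φ := fun _ : Fin 2 => ℝ) 0).hasFDerivAt
    have d1 := (q.hasDerivAt (x 1)).comp_hasFDerivAt x
      (ContinuousLinearMap.proj (R := ℝ) (φ := fun _ : Fin 2 => ℝ) 1).hasFDerivAt
    have := (d0.mul d1).fderiv
    simp only [Function.comp_def, ContinuousLinearMap.proj_apply] at this
    have e : (fun x : Fin 2 → ℝ => p.eval (x 0) * q.eval (x 1)) =
      (fun x : Fin 2 → ℝ => p.eval (x 0)) * (fun x : Fin 2 → ℝ => q.eval (x 1)) := rfl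
    rw [e, this]
    simp
    ring
  simp only [hd] at ibp
  simp only [Matrix.cons_val_zero, Matrix.cons_val_one, real_inner_self_eq_norm_sq, hh,
    one_pow, one_mul] at ibp
  rw [ibp, integral_add, integral_const_mul]
  · exact (hX.memLp_polynomial _ h (r := 2) (by simp)).integrable_mul
      (hX.memLp_polynomial _ g (r := 2) (by simp))
  · exact ((hX.memLp_polynomial _ h (r := 2) (by simp)).integrable_mul
      (hX.memLp_polynomial _ g (r := 2) (by simp))).const_mul _

/-- `E[H_p(X(h)) q(X(g))] = ⟪g, h⟫^p E[q^{(p)}(X(g))]`, by `p` integrations by parts. -/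
lemma integral_hermite_mul_polynomial {h : H} (hh : ‖h‖ = 1) (g : H) (p : ℕ)
    (q : Polynomial ℝ) :
    ∫ ω, Polynomial.aeval (X h ω) (Polynomial.hermite p) * q.eval (X g ω) ∂P =
      inner ℝ g h ^ p * ∫ ω, (Polynomial.derivative^[p] q).eval (X g ω) ∂P := by
  induction p generalizing q with
  | zero => simp
  | succ p ih =>
    have e : ∀ x : ℝ, Polynomial.aeval x (Polynomial.hermite (p + 1)) =
        x * ((Polynomial.hermite p).map (Int.castRingHom ℝ)).eval x -
        ((Polynomial.hermite p).map (Int.castRingHom ℝ)).derivative.eval x := by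
      intro x
      rw [Polynomial.hermite_succ, map_sub, map_mul, Polynomial.aeval_X, aeval_hermite,
        Polynomial.derivative_map, Polynomial.aeval_def]
      simp only [Polynomial.eval_map]
      rfl
    have e2 : ∀ ω, Polynomial.aeval (X h ω) (Polynomial.hermite (p + 1)) * q.eval (X g ω) =
        X h ω * (((Polynomial.hermite p).map (Int.castRingHom ℝ)).eval (X h ω) *
          q.eval (X g ω)) -
        ((Polynomial.hermite p).map (Int.castRingHom ℝ)).derivative.eval (X h ω) *
          q.eval (X g ω) := by
      intro ω; rw [e]; ring
    simp_rw [e2]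
    rw [integral_sub, hX.integral_mul_polynomial hh, Function.iterate_succ_apply, pow_succ',
      mul_assoc, ← ih q.derivative]
    · simp_rw [aeval_hermite]; ring
    · have := (hX.memLp_polynomial (Polynomial.X *
        ((Polynomial.hermite p).map (Int.castRingHom ℝ))) h (r := 2) (by simp)).integrable_mul
        (hX.memLp_polynomial q g (r := 2) (by simp))
      refine this.congr (ae_of_all _ fun ω => ?_)
      simp [mul_assoc]
    · exact (hX.memLp_polynomial _ h (r := 2) (by simp)).integrable_mul
        (hX.memLp_polynomial _ g (r := 2) (by simp))

lemma integral_hermite_mul_sq_sub_one {h : H} (hh : ‖h‖ = 1) (g : H) (p : ℕ) :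
    ∫ ω, Polynomial.aeval (X h ω) (Polynomial.hermite (p + 1)) * (X g ω ^ 2 - 1) ∂P =
      if p = 1 then 2 * inner ℝ g h ^ 2 else 0 := by
  have := hX.gaussian.isProbabilityMeasure
  have key := hX.integral_hermite_mul_polynomial hh g (p + 1) (Polynomial.X ^ 2 - 1)
  simp only [Polynomial.eval_sub, Polynomial.eval_pow, Polynomial.eval_X,
    Polynomial.eval_one] at key
  rw [key]
  rcases p with _ | _ | p
  · simp [integral_const_mul, hX.centered]
  · simp [mul_comm]
    norm_num
  · have : (Polynomial.derivative^[p + 1 + 1 + 1] (Polynomial.X ^ 2 - 1 : Polynomial ℝ)) = 0 :=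
      Polynomial.iterate_derivative_eq_zero (by
        refine lt_of_le_of_lt (b := 2) ?_ (by omega)
        compute_degree)
    rw [this]; simp

lemma integral_sq_sub_one {g : H} (hg : ‖g‖ = 1) : ∫ ω, (X g ω ^ 2 - 1) ∂P = 0 := by
  have := hX.gaussian.isProbabilityMeasure
  rw [integral_sub (hX.memLp_apply g (by simp)).integrable_sq (by simp)]
  have := hX.covariance g g
  simp_rw [← sq] at this
  rw [this, real_inner_self_eq_norm_sq, hg]
  simp

lemma integral_sq_sub_one_mul {h : H} (hh : ‖h‖ = 1) (g : H) :
    ∫ ω, (X h ω ^ 2 - 1) * (X g ω ^ 2 - 1) ∂P = 2 * inner ℝ g h ^ 2 := by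
  have := hX.integral_hermite_mul_sq_sub_one hh g 1
  simp only [Nat.reduceAdd, aeval_hermite_two] at this
  simpa using this

lemma memLp_sq_sub_one (h : H) {p : ENNReal} (hp : p ≠ ⊤) :
    MemLp (fun ω => X h ω ^ 2 - 1) p P := by
  simpa only [aeval_hermite_two] using hX.memLp_hermite 2 h hp

end IsIsonormal

/-! ### The double Wiener–Itô integral -/

lemma inner_lp_eq_integral (Y Z : Lp ℝ 2 P) : inner ℝ Y Z = ∫ ω, Y ω * Z ω ∂P := by
  rw [L2.inner_def]
  congr 1; ext ω; simp [mul_comm]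

variable (hX : IsIsonormal X P)
include hX

/-- The isometry property of the double integral: `E[I₂(f) I₂(g)] = 2 ⟪f, g⟫`. -/
lemma inner_doubleIntegralGraph {z w : HilbertTensorSq H × Lp ℝ 2 P}
    (hz : z ∈ doubleIntegralGraph X P) (hw : w ∈ doubleIntegralGraph X P) :
    inner ℝ z.2 w.2 = 2 * inner ℝ z.1 w.1 := by
  -- For fixed `w` the identity defines a closed subspace in `z`, so generators suffice.
  have red : ∀ (S : Set (HilbertTensorSq H × Lp ℝ 2 P)) (w : HilbertTensorSq H × Lp ℝ 2 P),
      (∀ z ∈ S, inner ℝ w.2 z.2 = 2 * inner ℝ w.1 z.1) →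
      ∀ z ∈ (Submodule.span ℝ S).topologicalClosure, inner ℝ w.2 z.2 = 2 * inner ℝ w.1 z.1 := by
    intro S w hS z hz
    let L : HilbertTensorSq H × Lp ℝ 2 P →L[ℝ] ℝ :=
      (innerSL ℝ w.2).comp (.snd ℝ _ _) - (2 : ℝ) • (innerSL ℝ w.1).comp (.fst ℝ _ _)
    have hle : (Submodule.span ℝ S).topologicalClosure ≤ L.ker := by
      refine Submodule.topologicalClosure_minimal _ (Submodule.span_le.2 fun z hz => ?_)
        L.isClosed_ker
      simp [L, hS z hz]
    have := hle hz
    simpa [L, sub_eq_zero] using this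
  refine red _ z (fun w' hw' => ?_) w hw
  rw [real_inner_comm, real_inner_comm w'.1]
  refine red _ w' (fun z' hz' => ?_) z hz
  obtain ⟨h, hh, h1, h2⟩ := hz'
  obtain ⟨g, hg, g1, g2⟩ := hw'
  rw [h1, g1, UniformSpace.Completion.inner_coe, TensorProduct.inner_tmul, ← sq,
    ← hX.integral_sq_sub_one_mul hh g, inner_lp_eq_integral]
  refine integral_congr_ae ?_
  filter_upwards [h2, g2] with ω e1 e2
  rw [e1, e2, aeval_hermite_two, aeval_hermite_two, mul_comm]

/-- The first chaos and all chaoses of order at least three are orthogonal to double integrals. -/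
lemma chaosProj_doubleIntegral_of_ne {z : HilbertTensorSq H × Lp ℝ 2 P}
    (hz : z ∈ doubleIntegralGraph X P) {p : ℕ} (hp : p ≠ 1) :
    chaosProj X P (p + 1) z.2 = 0 := by
  have : CompleteSpace (wienerChaos X P (p + 1)) :=
    (Submodule.isClosed_topologicalClosure _).completeSpace_coe
  rw [chaosProj, Submodule.starProjection_apply_eq_zero_iff, wienerChaos,
    Submodule.orthogonal_closure, Submodule.mem_orthogonal]
  intro Y hY
  induction hY using Submodule.span_induction with
  | zero => simp
  | add x y _ _ hx hy => rw [inner_add_left, hx, hy, add_zero]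
  | smul a x _ hx => rw [inner_smul_left, hx, mul_zero]
  | mem Y hY =>
    obtain ⟨h, hh, hYe⟩ := hY
    let L : HilbertTensorSq H × Lp ℝ 2 P →L[ℝ] ℝ := (innerSL ℝ Y).comp (.snd ℝ _ _)
    have hle : doubleIntegralGraph X P ≤ L.ker := by
      refine Submodule.topologicalClosure_minimal _ (Submodule.span_le.2 fun w hw => ?_)
        L.isClosed_ker
      obtain ⟨g, hg, g1, g2⟩ := hw
      have := hX.integral_hermite_mul_sq_sub_one hh g p
      rw [if_neg hp] at this
      change inner ℝ Y w.2 = 0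
      rw [inner_lp_eq_integral, ← this]
      refine integral_congr_ae ?_
      filter_upwards [hYe, g2] with ω e1 e2
      rw [e1, e2, aeval_hermite_two]
    exact hle hz

omit hX in
lemma chaosProj_two_doubleIntegral {z : HilbertTensorSq H × Lp ℝ 2 P}
    (hz : z ∈ doubleIntegralGraph X P) : chaosProj X P 2 z.2 = z.2 := by
  have : CompleteSpace (wienerChaos X P 2) :=
    (Submodule.isClosed_topologicalClosure _).completeSpace_coe
  rw [chaosProj, Submodule.starProjection_eq_self_iff]
  have hle : doubleIntegralGraph X P ≤
      (wienerChaos X P 2).comap (LinearMap.snd ℝ (HilbertTensorSq H) (Lp ℝ 2 P)) := by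
    refine Submodule.topologicalClosure_minimal _ (Submodule.span_le.2 fun w hw => ?_) ?_
    · obtain ⟨g, hg, g1, g2⟩ := hw
      exact Submodule.le_topologicalClosure _ (Submodule.subset_span ⟨g, hg, g2⟩)
    · exact (Submodule.isClosed_topologicalClosure _).preimage continuous_snd
  exact hle hz

/-- On the second chaos the pseudo-inverse of the generator is multiplication by `-1/2`. -/
lemma pseudoInverse_doubleIntegral {f : HilbertTensorSq H} {F : Ω → ℝ}
    (hF : IsDoubleIntegral X P f F) :
    pseudoInverse X P F =ᵐ[P] fun ω => -(1 / 2) * F ω := by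
  obtain ⟨hm, hz⟩ := hF
  rw [pseudoInverse, dif_pos hm]
  have hs : ∑' p : ℕ, (1 / ((p : ℝ) + 1)) • chaosProj X P (p + 1) (hm.toLp F) =
      (1 / 2 : ℝ) • hm.toLp F := by
    rw [tsum_eq_single 1 fun p hp => by
      rw [chaosProj_doubleIntegral_of_ne hX hz hp, smul_zero]]
    have := chaosProj_two_doubleIntegral hz
    simp only [Nat.cast_one, Nat.reduceAdd] at this ⊢
    rw [this]
    norm_num
  rw [hs]
  filter_upwards [Lp.coeFn_neg ((1 / 2 : ℝ) • hm.toLp F), Lp.coeFn_smul (1 / 2 : ℝ) (hm.toLp F),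
    hm.coeFn_toLp] with ω h1 h2 h3
  rw [h1, Pi.neg_apply, h2, Pi.smul_apply, h3, smul_eq_mul]
  ring

end Chaos

/-! ### Diagonalization of symmetric tensors -/

lemma summable_smul_orthonormal_iff {ι E : Type*} [NormedAddCommGroup E] [InnerProductSpace ℝ E]
    [CompleteSpace E] {v : ι → E} (hv : Orthonormal ℝ v) (c : ι → ℝ) :
    Summable (fun i => c i • v i) ↔ Summable (fun i => c i ^ 2) := by
  have := hv.orthogonalFamily.summable_iff_norm_sq_summable c
  simpa using this

lemma countable_of_orthonormal {ι E : Type*} [NormedAddCommGroup E] [InnerProductSpace ℝ E]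
    [TopologicalSpace.SeparableSpace E] {v : ι → E} (hv : Orthonormal ℝ v) : Countable ι := by
  have hd : Pairwise (Function.onFun Disjoint fun i => Metric.ball (v i) (1 / 2)) := by
    intro i j hij
    refine Metric.ball_disjoint_ball ?_
    have h2 : ‖v i - v j‖ ^ 2 = 2 := by
      rw [norm_sub_sq_real, hv.1 i, hv.1 j, hv.2 hij]; norm_num
    rw [dist_eq_norm]
    nlinarith [norm_nonneg (v i - v j)]
  exact hd.countable_of_isOpen_disjoint (fun i => Metric.isOpen_ball)
    fun i => ⟨v i, Metric.mem_ball_self (by norm_num)⟩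

section Spectral

universe u

variable {H : Type u} [NormedAddCommGroup H] [InnerProductSpace ℝ H]

/-- The elementary tensor `x ⊗ y` in the Hilbert space tensor square, as a continuous linear map
in `y`. -/
noncomputable def tensorL (x : H) : H →L[ℝ] HilbertTensorSq H :=
  (UniformSpace.Completion.toComplL (𝕜 := ℝ) (E := H ⊗[ℝ] H)).comp (TensorProduct.mkL ℝ H H x)

lemma tensorL_apply (x y : H) : tensorL x y = ((x ⊗ₜ[ℝ] y : H ⊗[ℝ] H) : HilbertTensorSq H) := rfl

lemma inner_tensorL (x y x' y' : H) :
    inner ℝ (tensorL x y) (tensorL x' y') = inner ℝ x x' * inner ℝ y y' := by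
  rw [tensorL_apply, tensorL_apply, UniformSpace.Completion.inner_coe, TensorProduct.inner_tmul]

lemma norm_tensorL_apply (x y : H) : ‖tensorL x y‖ = ‖x‖ * ‖y‖ := by
  rw [tensorL_apply, UniformSpace.Completion.norm_coe, TensorProduct.norm_tmul]

lemma tensorL_add (x x' : H) : tensorL (x + x') = tensorL x + tensorL x' := by
  ext y; simp [tensorL]

lemma tensorL_smul (a : ℝ) (x : H) : tensorL (a • x) = a • tensorL x := by
  ext y; simp [tensorL]

lemma eq_zero_of_inner_tensorL {t : HilbertTensorSq H}
    (ht : ∀ x y, inner ℝ t (tensorL x y) = 0) : t = 0 := by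
  have h : ∀ s : HilbertTensorSq H, inner ℝ t s = 0 := by
    intro s
    induction s using UniformSpace.Completion.induction_on with
    | hp => exact isClosed_eq (by fun_prop) (by fun_prop)
    | ih a =>
      induction a using TensorProduct.induction_on with
      | zero => exact inner_zero_right _
      | tmul x y => exact ht x y
      | add x y hx hy => rw [UniformSpace.Completion.coe_add, inner_add_right, hx, hy, add_zero]
  exact inner_self_eq_zero.1 (h t)

variable [CompleteSpace H]

/-- The Hilbert–Schmidt operator `T_f` of a tensor `f`, determined by
`⟪T_f x, y⟫ = ⟪f, x ⊗ y⟫`. -/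
noncomputable def tensorOp (f : HilbertTensorSq H) : H →L[ℝ] H :=
  LinearMap.mkContinuous
    { toFun x := (InnerProductSpace.toDual ℝ H).symm ((innerSL ℝ f).comp (tensorL x))
      map_add' x y := by rw [tensorL_add, ContinuousLinearMap.comp_add, map_add]
      map_smul' a x := by
        rw [tensorL_smul, ContinuousLinearMap.comp_smul, LinearIsometryEquiv.map_smulₛₗ]; simp }
    ‖f‖ fun x => by
      simp only [LinearMap.coe_mk, AddHom.coe_mk, LinearIsometryEquiv.norm_map]
      refine ContinuousLinearMap.opNorm_le_bound _ (by positivity) fun y => ?_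
      simp only [ContinuousLinearMap.comp_apply, innerSL_apply_apply]
      refine (norm_inner_le_norm _ _).trans ?_
      rw [norm_tensorL_apply, mul_assoc]

lemma inner_tensorOp (f : HilbertTensorSq H) (x y : H) :
    inner ℝ (tensorOp f x) y = inner ℝ f (tensorL x y) := by
  simp [tensorOp]

lemma norm_tensorOp_le (f : HilbertTensorSq H) : ‖tensorOp f‖ ≤ ‖f‖ :=
  LinearMap.mkContinuous_norm_le _ (norm_nonneg _) _

/-- `f ↦ T_f` as a continuous linear map. -/
noncomputable def tensorOpL : HilbertTensorSq H →L[ℝ] H →L[ℝ] H :=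
  LinearMap.mkContinuous
    { toFun f := tensorOp f
      map_add' f g := by
        ext x
        refine ext_inner_right ℝ fun y => ?_
        simp [inner_tensorOp, inner_add_left]
      map_smul' a f := by
        ext x
        refine ext_inner_right ℝ fun y => ?_
        simp [inner_tensorOp, inner_smul_left] }
    1 fun f => by simpa using norm_tensorOp_le f

lemma isCompactOperator_tensorOp {f : HilbertTensorSq H} (hf : f ∈ symTensorSq H) :
    IsCompactOperator (tensorOp f) := by
  have hle : symTensorSq H ≤
      (compactOperator (RingHom.id ℝ) H H).comap (tensorOpL (H := H) : _ →ₗ[ℝ] H →L[ℝ] H) := by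
    refine Submodule.topologicalClosure_minimal _ (Submodule.span_le.2 ?_) ?_
    · rintro _ ⟨h, rfl⟩
      -- `T_{h ⊗ h} = ⟪h, ·⟫ h` has rank one.
      have : tensorOp ((h ⊗ₜ[ℝ] h : H ⊗[ℝ] H) : HilbertTensorSq H) =
          (ContinuousLinearMap.toSpanSingleton ℝ h).comp (innerSL ℝ h) := by
        ext x
        refine ext_inner_right ℝ fun y => ?_
        rw [inner_tensorOp, ← tensorL_apply, inner_tensorL]
        simp [inner_smul_left]
      change IsCompactOperator (tensorOp _)
      rw [this]
      exact (isCompactOperator_of_locallyCompactSpace_rng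
        (ContinuousLinearMap.toSpanSingleton ℝ h)).comp_clm (innerSL ℝ h)
    · exact isClosed_setOfPred_isCompactOperator.preimage (tensorOpL (H := H)).continuous
  exact hle hf

lemma isSymmetric_tensorOp {f : HilbertTensorSq H} (hf : f ∈ symTensorSq H) :
    (tensorOp f : H →ₗ[ℝ] H).IsSymmetric := by
  intro x y
  let L : HilbertTensorSq H →L[ℝ] ℝ := innerSL ℝ (tensorL x y) - innerSL ℝ (tensorL y x)
  have hle : symTensorSq H ≤ L.ker := by
    refine Submodule.topologicalClosure_minimal _ (Submodule.span_le.2 ?_) L.isClosed_ker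
    rintro _ ⟨h, rfl⟩
    change L (tensorL h h) = 0
    simp [L, inner_tensorL, mul_comm]
  have : L f = 0 := hle hf
  simp only [ContinuousLinearMap.coe_coe]
  rw [real_inner_comm _ x, inner_tensorOp, inner_tensorOp]
  simp only [L, sub_apply, innerSL_apply_apply] at this
  rw [real_inner_comm, real_inner_comm (tensorL y x)]
  linarith

/-- A compact self-adjoint operator has a total orthonormal family of eigenvectors. -/
lemma exists_orthonormal_eigenvectors {T : H →L[ℝ] H} (hc : IsCompactOperator T)
    (hs : (T : H →ₗ[ℝ] H).IsSymmetric) :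
    ∃ (ι : Type u) (e : ι → H) (μ : ι → ℝ), Orthonormal ℝ e ∧
      (Submodule.span ℝ (Set.range e))ᗮ = ⊥ ∧ ∀ i, T (e i) = μ i • e i := by
  let V : ℝ → Submodule ℝ H := fun μ => Module.End.eigenspace (T : H →ₗ[ℝ] H) μ
  have hcl : ∀ μ, CompleteSpace (V μ) := fun μ =>
    (ContinuousLinearMap.isClosed_eigenspace T μ).completeSpace_coe
  choose w b hb using fun μ => exists_hilbertBasis ℝ (V μ)
  have hof : OrthogonalFamily ℝ (fun μ => V μ) fun μ => (V μ).subtypeₗᵢ :=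
    hs.orthogonalFamily_eigenspaces
  refine ⟨Σ μ, w μ, fun a => (b a.1 a.2 : V a.1), fun a => a.1,
    hof.orthonormal_sigma_orthonormal fun μ => (b μ).orthonormal, ?_, fun a => ?_⟩
  · rw [Submodule.eq_bot_iff]
    intro x hx
    have htop : x ∈ (⨆ μ, V μ)ᗮ := by
      rw [← Submodule.iInf_orthogonal, Submodule.mem_iInf]
      intro μ
      rw [Submodule.mem_orthogonal]
      intro y hy
      let L : V μ →L[ℝ] ℝ := (innerSL ℝ x).comp (V μ).subtypeL
      have hle : (⊤ : Submodule ℝ (V μ)) ≤ L.ker := by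
        rw [← (b μ).dense_span]
        refine Submodule.topologicalClosure_minimal _ (Submodule.span_le.2 ?_) L.isClosed_ker
        rintro _ ⟨i, rfl⟩
        have := (Submodule.mem_orthogonal _ _).1 hx (b μ i : H)
          (Submodule.subset_span ⟨⟨μ, i⟩, rfl⟩)
        rw [real_inner_comm] at this
        exact this
      have : L ⟨y, hy⟩ = 0 := hle trivial
      rw [real_inner_comm]
      exact this
    rw [ContinuousLinearMap.orthogonalComplement_iSup_eigenspaces_eq_bot hc hs] at htop
    simpa using htop
  · exact Module.End.mem_eigenspace_iff.1 (b a.1 a.2).2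

/-- Every symmetric tensor is diagonal in some countable orthonormal family:
`f = ∑ c_j e_j ⊗ e_j`. -/
theorem exists_diagonalization [TopologicalSpace.SeparableSpace H]
    {f : HilbertTensorSq H} (hf : f ∈ symTensorSq H) :
    ∃ (ι : Type u) (_ : Countable ι) (e : ι → H) (c : ι → ℝ), Orthonormal ℝ e ∧
      HasSum (fun i => c i • tensorL (e i) (e i)) f := by
  obtain ⟨ι, e, μ, he, htot, hT⟩ := exists_orthonormal_eigenvectors
    (isCompactOperator_tensorOp hf) (isSymmetric_tensorOp hf)
  have hv : Orthonormal ℝ (fun i => tensorL (e i) (e i)) := by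
    classical
    rw [orthonormal_iff_ite]
    intro i j
    rw [inner_tensorL, orthonormal_iff_ite.1 he]
    split_ifs <;> simp
  have hco : ∀ i j, inner ℝ f (tensorL (e i) (e j)) = μ i * inner ℝ (e i) (e j) := by
    intro i j
    rw [← inner_tensorOp, hT, inner_smul_left]; simp
  have hc : Summable (fun i => μ i ^ 2) := by
    have := hv.inner_products_summable (x := f)
    refine this.congr fun i => ?_
    rw [real_inner_comm, hco, real_inner_self_eq_norm_sq, he.1 i]
    simp
  have hsum := ((summable_smul_orthonormal_iff hv μ).2 hc).hasSum
  refine ⟨ι, countable_of_orthonormal he, e, μ, he, ?_⟩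
  set f' := ∑' i, μ i • tensorL (e i) (e i) with hf'
  -- The difference has vanishing coefficients along all `e i ⊗ e j`, hence its operator is zero.
  have hco' : ∀ i j, inner ℝ f' (tensorL (e i) (e j)) = μ i * inner ℝ (e i) (e j) := by
    intro i j
    have h1 := (innerSL ℝ (tensorL (e i) (e j))).hasSum hsum
    have h2 := hasSum_single (f := fun k => innerSL ℝ (tensorL (e i) (e j))
      (μ k • tensorL (e k) (e k))) i fun k hk => by
        simp [inner_tensorL, he.2 hk.symm]
    rw [real_inner_comm, ← innerSL_apply_apply ℝ, h1.unique h2]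
    simp [inner_tensorL, he.1 i, real_inner_comm]
  have hdense : (Submodule.span ℝ (Set.range e)).topologicalClosure = ⊤ :=
    (Submodule.topologicalClosure_eq_top_iff).2 htot
  have ext0 : ∀ L : H →L[ℝ] ℝ, (∀ i, L (e i) = 0) → L = 0 := by
    intro L hL
    have hle : (⊤ : Submodule ℝ H) ≤ L.ker := by
      rw [← hdense]
      refine Submodule.topologicalClosure_minimal _ (Submodule.span_le.2 ?_) L.isClosed_ker
      rintro _ ⟨i, rfl⟩
      exact hL i
    ext x
    exact hle trivial
  have hz : f - f' = 0 := by
    refine eq_zero_of_inner_tensorL fun x y => ?_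
    have h1 : ∀ i y, inner ℝ (f - f') (tensorL (e i) y) = 0 := by
      intro i y
      have := ext0 ((innerSL ℝ (f - f')).comp (tensorL (e i))) fun j => by
        rw [ContinuousLinearMap.comp_apply, innerSL_apply_apply, inner_sub_left, hco, hco',
          sub_self]
      exact DFunLike.congr_fun this y
    have := ext0 ((innerSL ℝ y).comp (tensorOp (f - f'))) fun i => by
      rw [ContinuousLinearMap.comp_apply, innerSL_apply_apply, real_inner_comm, inner_tensorOp, h1]
    rw [← inner_tensorOp, real_inner_comm]
    exact DFunLike.congr_fun this x
  rw [sub_eq_zero.1 hz]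
  exact hsum

end Spectral

/-! ### Unconditional expansions in `Lᵖ` -/

section Expansion

variable {Ω E ι : Type*} [MeasurableSpace Ω] {P : Measure Ω} [NormedAddCommGroup E]
  [NormedSpace ℝ E] {p : ENNReal} {v : ι → Ω → E} {c c' : ι → ℝ} {Y Y' : Ω → E}

/-- `Y = ∑ c_i v_i` with unconditional convergence in `Lᵖ`. -/
def HasLpSum (p : ENNReal) (P : Measure Ω) (v : ι → Ω → E) (c : ι → ℝ) (Y : Ω → E) : Prop :=
  MemLp Y p P ∧
    Tendsto (fun s : Finset ι => eLpNorm (Y - fun ω => ∑ i ∈ s, c i • v i ω) p P) atTop (𝓝 0)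

lemma toLp_sum_smul [Fact (1 ≤ p)] (hv : ∀ i, MemLp (v i) p P) (s : Finset ι) :
    ∑ i ∈ s, c i • (hv i).toLp (v i) =
      (memLp_finsetSum s fun i _ => (hv i).const_smul (c i)).toLp
        (fun ω => ∑ i ∈ s, c i • v i ω) := by
  classical
  apply Lp.ext
  refine (Lp.coeFn_finsetSum s _).trans ?_
  have h : ∀ i, (c i • (hv i).toLp (v i) : Lp E p P) =ᵐ[P] c i • v i := fun i =>
    (Lp.coeFn_smul _ _).trans ((hv i).coeFn_toLp.const_smul (c i))
  refine EventuallyEq.trans ?_ (MemLp.coeFn_toLp _).symm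
  have := eventuallyEq_sum (s := s) fun i _ => h i
  filter_upwards [this] with ω hω
  simpa using hω

lemma hasLpSum_iff [Fact (1 ≤ p)] (hv : ∀ i, MemLp (v i) p P) (hY : MemLp Y p P) :
    HasLpSum p P v c Y ↔ HasSum (fun i => c i • (hv i).toLp (v i)) (hY.toLp Y) := by
  simp only [HasSum, SummationFilter.unconditional_filter, HasLpSum, hY, true_and, toLp_sum_smul]
  rw [Lp.tendsto_Lp_iff_tendsto_eLpNorm'' _ _ _ hY]
  simp_rw [eLpNorm_sub_comm Y]

lemma HasLpSum.congr (h : HasLpSum p P v c Y) (e : Y =ᵐ[P] Y') : HasLpSum p P v c Y' := by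
  refine ⟨h.1.ae_eq e, h.2.congr fun s => eLpNorm_congr_ae ?_⟩
  filter_upwards [e] with ω hω
  simp [hω]

lemma HasLpSum.unique [Fact (1 ≤ p)] (hv : ∀ i, MemLp (v i) p P) (h : HasLpSum p P v c Y)
    (h' : HasLpSum p P v c Y') : Y =ᵐ[P] Y' := by
  have h1 := (hasLpSum_iff hv h.1).1 h
  have h2 := (hasLpSum_iff hv h'.1).1 h'
  exact (MemLp.toLp_eq_toLp_iff _ _).1 (h1.unique h2)

lemma HasLpSum.sub [Fact (1 ≤ p)] (hv : ∀ i, MemLp (v i) p P) (h : HasLpSum p P v c Y)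
    (h' : HasLpSum p P v c' Y') : HasLpSum p P v (fun i => c i - c' i) (Y - Y') := by
  have h1 := (hasLpSum_iff hv h.1).1 h
  have h2 := (hasLpSum_iff hv h'.1).1 h'
  refine (hasLpSum_iff hv (h.1.sub h'.1)).2 ?_
  rw [MemLp.toLp_sub]
  simpa only [sub_smul] using h1.sub h2

lemma HasLpSum.const_smul [Fact (1 ≤ p)] (hv : ∀ i, MemLp (v i) p P) (h : HasLpSum p P v c Y)
    (a : ℝ) : HasLpSum p P v (fun i => a * c i) (a • Y) := by
  have h1 := (hasLpSum_iff hv h.1).1 h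
  refine (hasLpSum_iff hv (h.1.const_smul a)).2 ?_
  rw [MemLp.toLp_const_smul]
  simpa only [mul_smul] using h1.const_smul a

lemma exists_hasLpSum_of_summable [Fact (1 ≤ p)] (hv : ∀ i, MemLp (v i) p P)
    (h : Summable (fun i => c i • (hv i).toLp (v i))) : ∃ Y, HasLpSum p P v c Y := by
  refine ⟨(∑' i, c i • (hv i).toLp (v i) : Lp E p P), (hasLpSum_iff hv (Lp.memLp _)).2 ?_⟩
  rw [Lp.toLp_coeFn]
  exact h.hasSum

end Expansion

section OrthogonalExpansion

variable {Ω E ι : Type*} [MeasurableSpace Ω] {P : Measure Ω} [NormedAddCommGroup E]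
  [InnerProductSpace ℝ E] {v : ι → Ω → E} {c : ι → ℝ} {Y : Ω → E}

/-- `v` is an orthogonal family in `L²` all of whose members have squared norm `κ`. -/
structure IsOrthogonalL2 (P : Measure Ω) (v : ι → Ω → E) (κ : ℝ) : Prop where
  pos : 0 < κ
  memLp : ∀ i, MemLp (v i) 2 P
  norm_sq : ∀ i, ∫ ω, inner ℝ (v i ω) (v i ω) ∂P = κ
  orthogonal : ∀ i j, i ≠ j → ∫ ω, inner ℝ (v i ω) (v j ω) ∂P = 0

namespace IsOrthogonalL2

variable {κ : ℝ} (hv : IsOrthogonalL2 P v κ)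
include hv

lemma inner_toLp (i j : ι) :
    inner ℝ ((hv.memLp i).toLp (v i)) ((hv.memLp j).toLp (v j)) =
      ∫ ω, inner ℝ (v i ω) (v j ω) ∂P := by
  rw [L2.inner_def]
  refine integral_congr_ae ?_
  filter_upwards [(hv.memLp i).coeFn_toLp, (hv.memLp j).coeFn_toLp] with ω h1 h2
  rw [h1, h2]

lemma orthonormal : Orthonormal ℝ (fun i => (√κ)⁻¹ • (hv.memLp i).toLp (v i)) := by
  classical
  rw [orthonormal_iff_ite]
  intro i j
  rw [inner_smul_left, inner_smul_right, hv.inner_toLp]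
  have hκ := hv.pos
  split_ifs with h
  · subst h
    rw [hv.norm_sq]
    have := Real.mul_self_sqrt hκ.le
    have h0 : √κ ≠ 0 := (Real.sqrt_pos.2 hκ).ne'
    simp only [conj_trivial]
    field_simp
    nlinarith
  · rw [hv.orthogonal i j h]; simp

lemma smul_eq (i : ι) : c i • (hv.memLp i).toLp (v i) =
    (c i * √κ) • ((√κ)⁻¹ • (hv.memLp i).toLp (v i)) := by
  rw [smul_smul, mul_assoc, mul_inv_cancel₀ (Real.sqrt_pos.2 hv.pos).ne', mul_one]

lemma summable_iff [CompleteSpace E] :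
    Summable (fun i => c i • (hv.memLp i).toLp (v i)) ↔ Summable (fun i => c i ^ 2) := by
  simp_rw [hv.smul_eq]
  rw [summable_smul_orthonormal_iff hv.orthonormal]
  simp_rw [mul_pow, Real.sq_sqrt hv.pos.le]
  exact summable_mul_right_iff hv.pos.ne'

lemma exists_hasLpSum [CompleteSpace E] (hc : Summable (fun i => c i ^ 2)) :
    ∃ Y, HasLpSum 2 P v c Y :=
  exists_hasLpSum_of_summable hv.memLp (hv.summable_iff.2 hc)

/-- Parseval's identity. -/
lemma integral_norm_sq [CompleteSpace E] (h : HasLpSum 2 P v c Y) :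
    ∫ ω, ‖Y ω‖ ^ 2 ∂P = κ * ∑' i, c i ^ 2 := by
  have hs := (hasLpSum_iff hv.memLp h.1).1 h
  have hc : Summable (fun i => c i ^ 2) := hv.summable_iff.1 hs.summable
  have h1 : Tendsto (fun s : Finset ι => ‖∑ i ∈ s, c i • (hv.memLp i).toLp (v i)‖ ^ 2) atTop
      (𝓝 (‖h.1.toLp Y‖ ^ 2)) := (hs.norm).pow 2
  have h2 : ∀ s : Finset ι, ‖∑ i ∈ s, c i • (hv.memLp i).toLp (v i)‖ ^ 2 =
      κ * ∑ i ∈ s, c i ^ 2 := by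
    intro s
    simp_rw [hv.smul_eq]
    rw [← real_inner_self_eq_norm_sq, hv.orthonormal.inner_sum, Finset.mul_sum]
    refine Finset.sum_congr rfl fun i _ => ?_
    have := Real.mul_self_sqrt hv.pos.le
    simp only [conj_trivial]
    linear_combination c i ^ 2 * this
  simp_rw [h2] at h1
  have h3 := tendsto_nhds_unique h1 (hc.hasSum.const_mul κ)
  rw [← h3, ← real_inner_self_eq_norm_sq, L2.inner_def]
  refine integral_congr_ae ?_
  filter_upwards [h.1.coeFn_toLp] with ω hω
  rw [hω, real_inner_self_eq_norm_sq]

end IsOrthogonalL2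

end OrthogonalExpansion

/-! ### Linear and quadratic functionals of an orthonormal family -/

section Functionals

variable {Ω H ι : Type*} [MeasurableSpace Ω] [NormedAddCommGroup H] [InnerProductSpace ℝ H]
  {P : Measure Ω} {X : H → Ω → ℝ} {e : ι → H}

/-- The centered squares `X(e_j)² - 1`. -/
def centeredSq (X : H → Ω → ℝ) (e : ι → H) (j : ι) (ω : Ω) : ℝ := X (e j) ω ^ 2 - 1

/-- The `H`-valued random variables `X(e_j) e_j`. -/
noncomputable def gaussianVec (X : H → Ω → ℝ) (e : ι → H) (j : ι) (ω : Ω) : H :=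
  X (e j) ω • e j

/-- `Y = k + ∑ c_j (X(e_j)² - 1)` in `L²`. -/
def IsQuadratic (X : H → Ω → ℝ) (P : Measure Ω) (e : ι → H) (c : ι → ℝ) (k : ℝ)
    (Y : Ω → ℝ) : Prop := HasLpSum 2 P (centeredSq X e) c (fun ω => Y ω - k)

lemma finset_sum_eq_sum_fin {ι E : Type*} [AddCommMonoid E] (s : Finset ι) (F : ι → E) :
    ∑ j ∈ s, F j = ∑ i : Fin s.card, F (s.equivFin.symm i) := by
  rw [← Finset.sum_coe_sort]
  exact (Equiv.sum_comp s.equivFin.symm fun j : s => F j).symm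

omit [NormedAddCommGroup H] [InnerProductSpace ℝ H] in
lemma IsQuadratic.memLp [IsFiniteMeasure P] {c : ι → ℝ} {k : ℝ} {Y : Ω → ℝ}
    (hY : IsQuadratic X P e c k Y) : MemLp Y 2 P :=
  (hY.1.add (memLp_const k)).ae_eq (ae_of_all _ fun ω => by simp)

omit [MeasurableSpace Ω] in
/-- A finite quadratic functional is smooth, and its derivative is computed termwise. -/
lemma isSmoothPair_finset_sum (e : ι → H) (c : ι → ℝ) (k : ℝ) (s : Finset ι) :
    IsSmoothPair X (fun ω => ∑ j ∈ s, c j • centeredSq X e j ω + k)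
      (fun ω => ∑ j ∈ s, (2 * c j) • gaussianVec X e j ω) := by
  let L : Fin s.card → (Fin s.card → ℝ) →L[ℝ] ℝ := fun i => .proj i
  refine ⟨s.card, fun i => e (s.equivFin.symm i),
    fun x => ∑ i, c (s.equivFin.symm i) * (L i x ^ 2 - 1) + k, ?_, ?_, ?_⟩
  · have : ∀ i, Function.HasTemperateGrowth (fun x => L i x) := fun i =>
      (L i).hasTemperateGrowth
    fun_prop
  · ext ω
    rw [finset_sum_eq_sum_fin]
    simp [centeredSq, L]
  · ext ω
    rw [finset_sum_eq_sum_fin]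
    refine Finset.sum_congr rfl fun i _ => ?_
    have hd : HasFDerivAt
        (fun x : Fin s.card → ℝ => ∑ i, c (s.equivFin.symm i) * (L i x ^ 2 - 1) + k)
        (∑ i, c (s.equivFin.symm i) • ((2 * X (e (s.equivFin.symm i)) ω) • L i))
        (fun j => X (e (s.equivFin.symm j)) ω) := by
      refine HasFDerivAt.add_const _ (HasFDerivAt.fun_sum fun i _ => ?_)
      have := (((L i).hasFDerivAt (x := fun j => X (e (s.equivFin.symm j)) ω)).pow 2).sub_const 1
      convert! this.const_mul (c (s.equivFin.symm i)) using 2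
      simp [L]
    rw [hd.fderiv]
    simp only [gaussianVec, sum_apply, smul_apply, L,
      ContinuousLinearMap.proj_apply, smul_eq_mul, Pi.single_apply, mul_ite, mul_one, mul_zero,
      Finset.sum_ite_eq', Finset.mem_univ, if_true, smul_smul]
    congr 1
    ring

variable (hX : IsIsonormal X P) (he : Orthonormal ℝ e)
include hX he

lemma isOrthogonalL2_centeredSq : IsOrthogonalL2 P (centeredSq X e) 2 where
  pos := by norm_num
  memLp i := hX.memLp_sq_sub_one (e i) (by simp)
  norm_sq i := by
    have := hX.integral_sq_sub_one_mul (he.1 i) (e i)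
    rw [real_inner_self_eq_norm_sq, he.1 i] at this
    simpa only [RCLike.inner_apply, conj_trivial, centeredSq, one_pow, mul_one] using this
  orthogonal i j hij := by
    have := hX.integral_sq_sub_one_mul (he.1 j) (e i)
    simpa [he.2 hij, centeredSq] using this

lemma isOrthogonalL2_gaussianVec : IsOrthogonalL2 P (gaussianVec X e) 1 where
  pos := one_pos
  memLp i := by
    have h := hX.memLp_apply (e i) (p := 2) (by simp)
    exact MemLp.of_le_mul (c := 1) h (h.1.smul_const _)
      (ae_of_all _ fun ω => by simp [gaussianVec, norm_smul, he.1 i])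
  norm_sq i := by
    have := hX.covariance (e i) (e i)
    rw [real_inner_self_eq_norm_sq, he.1 i] at this
    simpa only [gaussianVec, inner_smul_left, inner_smul_right, real_inner_self_eq_norm_sq,
      he.1 i, conj_trivial, one_pow, mul_one] using this
  orthogonal i j hij := by
    simp [gaussianVec, inner_smul_left, inner_smul_right, he.2 hij]

omit he in
/-- The Malliavin derivative of `k + ∑ c_j (X(e_j)² - 1)` is `∑ 2 c_j X(e_j) e_j`. -/
lemma IsQuadratic.isMalliavinDerivative [Countable ι] {c : ι → ℝ} {k : ℝ} {Y : Ω → ℝ}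
    {U : Ω → H} (hY : IsQuadratic X P e c k Y)
    (hU : HasLpSum 2 P (gaussianVec X e) (fun j => 2 * c j) U) :
    IsMalliavinDerivative X P Y U := by
  have := hX.gaussian.isProbabilityMeasure
  obtain ⟨s, hs⟩ := exists_seq_tendsto (atTop : Filter (Finset ι))
  refine ⟨hY.memLp, hU.1, _, _,
    fun n => isSmoothPair_finset_sum e c k (s n), ?_, hU.2.comp hs⟩
  refine (hY.2.comp hs).congr fun n => ?_
  simp only [Function.comp_apply]
  congr 1
  ext ω
  simp only [Pi.sub_apply]
  ring

/-- The inner product of two linear functionals is a quadratic one. -/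
lemma isQuadratic_inner [CompleteSpace H] {d d' : ι → ℝ} {U U' : Ω → H}
    (hU : HasLpSum 2 P (gaussianVec X e) d U) (hU' : HasLpSum 2 P (gaussianVec X e) d' U') :
    IsQuadratic X P e (fun j => d j * d' j) (∑' j, d j * d' j)
      (fun ω => inner ℝ (U ω) (U' ω)) := by
  have hprob := hX.gaussian.isProbabilityMeasure
  have hv := isOrthogonalL2_gaussianVec hX he
  have hw := isOrthogonalL2_centeredSq hX he
  have hd := hv.summable_iff.1 ((hasLpSum_iff hv.memLp hU.1).1 hU).summable
  have hd' := hv.summable_iff.1 ((hasLpSum_iff hv.memLp hU'.1).1 hU').summable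
  have hdd : Summable fun j => d j * d' j := by
    refine Summable.of_norm_bounded (hd.add hd') fun j => ?_
    rw [Real.norm_eq_abs, abs_le]
    constructor <;> nlinarith [sq_nonneg (d j + d' j), sq_nonneg (d j - d' j)]
  have hdd2 : Summable fun j => (d j * d' j) ^ 2 := by
    refine Summable.of_nonneg_of_le (fun j => sq_nonneg _) (fun j => ?_)
      (hdd.norm.mul_left (∑' j, ‖d j * d' j‖))
    rw [← sq_abs, sq, ← Real.norm_eq_abs]
    exact mul_le_mul_of_nonneg_right (hdd.norm.le_tsum j fun _ _ => norm_nonneg _) (norm_nonneg _)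
  obtain ⟨Z, hZ⟩ := hw.exists_hasLpSum hdd2
  set κ := ∑' j, d j * d' j with hκ
  -- Both `Z + κ` and the inner product are `L¹` limits of the same finite sums.
  have hUs : ∀ s : Finset ι, MemLp (fun ω => ∑ j ∈ s, d j • gaussianVec X e j ω) 2 P :=
    fun s => memLp_finsetSum s fun j _ => (hv.memLp j).const_smul (d j)
  have hUs' : ∀ s : Finset ι, MemLp (fun ω => ∑ j ∈ s, d' j • gaussianVec X e j ω) 2 P :=
    fun s => memLp_finsetSum s fun j _ => (hv.memLp j).const_smul (d' j)
  have hWs : ∀ s : Finset ι, MemLp (fun ω => ∑ j ∈ s, (d j * d' j) • centeredSq X e j ω) 2 P :=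
    fun s => memLp_finsetSum s fun j _ => (hw.memLp j).const_smul (d j * d' j)
  have hin : ∀ (s : Finset ι) ω, inner ℝ (∑ j ∈ s, d j • gaussianVec X e j ω)
      (∑ j ∈ s, d' j • gaussianVec X e j ω) =
      ∑ j ∈ s, (d j * d' j) • centeredSq X e j ω + ∑ j ∈ s, d j * d' j := by
    intro s ω
    simp only [gaussianVec, smul_smul]
    rw [he.inner_sum, ← Finset.sum_add_distrib]
    refine Finset.sum_congr rfl fun j _ => ?_
    simp only [centeredSq, smul_eq_mul, conj_trivial]
    ring
  have t1 := tendsto_eLpNorm_one_inner hU.1 hU'.1 hUs hUs' hU.2 hU'.2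
  have t2 : Tendsto (fun s : Finset ι => ENNReal.ofReal |κ - ∑ j ∈ s, d j * d' j|) atTop
      (𝓝 0) := by
    have : Tendsto (fun s : Finset ι => |κ - ∑ j ∈ s, d j * d' j|) atTop (𝓝 0) := by
      have h1 : Tendsto (fun s : Finset ι => κ - ∑ j ∈ s, d j * d' j) atTop (𝓝 (κ - κ)) :=
        tendsto_const_nhds.sub hdd.hasSum
      simpa only [sub_self, abs_zero] using h1.abs
    simpa using ENNReal.tendsto_ofReal this
  have hUi := memLp_one_inner hU.1 hU'.1
  have hZ1 : MemLp Z 1 P := hZ.1.mono_exponent (by norm_num)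
  have hzero : eLpNorm (fun ω => Z ω - (inner ℝ (U ω) (U' ω) - κ)) 1 P = 0 := by
    refine le_antisymm (ge_of_tendsto' (by simpa using (t1.add hZ.2).add t2) fun s => ?_)
      zero_le
    have heq : (fun ω => Z ω - (inner ℝ (U ω) (U' ω) - κ)) =
        (Z - fun ω => ∑ j ∈ s, (d j * d' j) • centeredSq X e j ω) -
        ((fun ω => inner ℝ (U ω) (U' ω)) - fun ω => inner ℝ (∑ j ∈ s, d j • gaussianVec X e j ω)
          (∑ j ∈ s, d' j • gaussianVec X e j ω)) + fun _ => (κ - ∑ j ∈ s, d j * d' j) := by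
      ext ω
      simp only [Pi.add_apply, Pi.sub_apply, hin]
      ring
    have m1 := (hZ.1.sub (hWs s)).1
    have m2 := (hUi.sub (memLp_one_inner (hUs s) (hUs' s))).1
    rw [heq]
    refine (eLpNorm_add_le (m1.sub m2) aestronglyMeasurable_const le_rfl).trans
      (add_le_add ?_ ?_)
    · refine (eLpNorm_sub_le m1 m2 le_rfl).trans ?_
      rw [add_comm]
      exact add_le_add le_rfl (eLpNorm_le_eLpNorm_of_exponent_le (by norm_num) m1)
    · rw [eLpNorm_const _ one_ne_zero (NeZero.ne P)]
      simp [← ofReal_norm]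
  replace hzero := (eLpNorm_eq_zero_iff (hZ1.sub (hUi.sub (memLp_const κ))).1 one_ne_zero).1 hzero
  refine hZ.congr ?_
  filter_upwards [hzero] with ω hω
  exact sub_eq_zero.1 hω

lemma IsQuadratic.integral_eq [CompleteSpace H] {c : ι → ℝ} {Y : Ω → ℝ}
    (hY : IsQuadratic X P e c 0 Y) : ∫ ω, Y ω ∂P = 0 := by
  have hprob := hX.gaussian.isProbabilityMeasure
  have hw := isOrthogonalL2_centeredSq hX he
  have hWs : ∀ s : Finset ι, MemLp (fun ω => ∑ j ∈ s, c j • centeredSq X e j ω) 2 P :=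
    fun s => memLp_finsetSum s fun j _ => (hw.memLp j).const_smul (c j)
  have t := tendsto_integral_inner (W := fun _ => (1 : ℝ)) (Wn := fun _ _ => (1 : ℝ))
    hY.1 (memLp_const 1) hWs (fun _ => memLp_const 1) hY.2
    (by simp)
  have hz : ∀ s : Finset ι, ∫ ω, inner ℝ (∑ j ∈ s, c j • centeredSq X e j ω) (1 : ℝ) ∂P = 0 := by
    intro s
    simp only [RCLike.inner_apply, conj_trivial, one_mul]
    rw [integral_finsetSum (f := fun j ω => c j • centeredSq X e j ω) _ fun j _ =>
      ((hw.memLp j).const_smul (c j)).integrable (by norm_num)]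
    refine Finset.sum_eq_zero fun j _ => ?_
    rw [integral_smul]
    simp [centeredSq, hX.integral_sq_sub_one (he.1 j)]
  simp_rw [hz] at t
  have := tendsto_nhds_unique tendsto_const_nhds t
  simpa using this.symm

/-- The variance of a quadratic functional does not see the constant term. -/
lemma IsQuadratic.variance_eq [CompleteSpace H] {c : ι → ℝ} {k : ℝ} {Y : Ω → ℝ}
    (hY : IsQuadratic X P e c k Y) : variance Y P = 2 * ∑' j, c j ^ 2 := by
  have hprob := hX.gaussian.isProbabilityMeasure
  have hw := isOrthogonalL2_centeredSq hX he
  have h0 : IsQuadratic X P e c 0 (fun ω => Y ω - k) := by simpa [IsQuadratic] using hY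
  have hYm : MemLp Y 2 P := hY.memLp
  have hm := h0.integral_eq hX he
  have hv : variance (fun ω => Y ω - k) P = variance Y P := variance_sub_const hYm.1 k
  rw [← hv, variance_of_integral_eq_zero hY.1.1.aemeasurable hm, ← hw.integral_norm_sq hY]
  simp

end Functionals

/-! ### Third and fourth moments of quadratic functionals -/

section Moments

variable {Ω : Type*} [MeasurableSpace Ω] {P : Measure Ω}

/-- A centered random variable with all moments, whose second, third and fourth moments are
`m₂`, `m₃`, `m₄`. -/
structure HasCenteredMoments (P : Measure Ω) (S : Ω → ℝ) (m₂ m₃ m₄ : ℝ) : Prop where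
  integrable : ∀ n : ℕ, Integrable (fun ω => S ω ^ n) P
  mean : ∫ ω, S ω ∂P = 0
  two : ∫ ω, S ω ^ 2 ∂P = m₂
  three : ∫ ω, S ω ^ 3 ∂P = m₃
  four : ∫ ω, S ω ^ 4 ∂P = m₄

namespace HasCenteredMoments

variable {S Y : Ω → ℝ} {m₂ m₃ m₄ k₂ k₃ k₄ : ℝ}

lemma const_mul (h : HasCenteredMoments P S m₂ m₃ m₄) (a : ℝ) :
    HasCenteredMoments P (fun ω => a * S ω) (a ^ 2 * m₂) (a ^ 3 * m₃) (a ^ 4 * m₄) where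
  integrable n := by simpa only [mul_pow] using (h.integrable n).const_mul (a ^ n)
  mean := by rw [integral_const_mul, h.mean, mul_zero]
  two := by simp only [mul_pow]; rw [integral_const_mul, h.two]
  three := by simp only [mul_pow]; rw [integral_const_mul, h.three]
  four := by simp only [mul_pow]; rw [integral_const_mul, h.four]

/-- Moments of a sum of two independent centered variables. -/
lemma add [IsProbabilityMeasure P] (h : HasCenteredMoments P S m₂ m₃ m₄)
    (h' : HasCenteredMoments P Y k₂ k₃ k₄) (hind : IndepFun S Y P) :
    HasCenteredMoments P (fun ω => S ω + Y ω) (m₂ + k₂) (m₃ + k₃) (m₄ + 6 * m₂ * k₂ + k₄) := by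
  have hi : ∀ a b : ℕ, Integrable (fun ω => S ω ^ a * Y ω ^ b) P := fun a b =>
    (hind.comp (measurable_id.pow_const a) (measurable_id.pow_const b)).integrable_mul
      (h.integrable a) (h'.integrable b)
  have hm : ∀ a b : ℕ, ∫ ω, S ω ^ a * Y ω ^ b ∂P =
      (∫ ω, S ω ^ a ∂P) * ∫ ω, Y ω ^ b ∂P := fun a b =>
    (hind.comp (measurable_id.pow_const a) (measurable_id.pow_const b)).integral_mul_eq_mul_integral
      (h.integrable a).1 (h'.integrable b).1
  have ex : ∀ n : ℕ, ∀ ω, (S ω + Y ω) ^ n =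
      ∑ j ∈ Finset.range (n + 1), n.choose j * (S ω ^ j * Y ω ^ (n - j)) := by
    intro n ω
    rw [add_pow]
    exact Finset.sum_congr rfl fun j _ => by ring
  have hsum : ∀ n : ℕ, ∫ ω, (S ω + Y ω) ^ n ∂P =
      ∑ j ∈ Finset.range (n + 1), n.choose j * ((∫ ω, S ω ^ j ∂P) * ∫ ω, Y ω ^ (n - j) ∂P) := by
    intro n
    simp_rw [ex]
    rw [integral_finsetSum _ fun j _ => (hi j (n - j)).const_mul _]
    exact Finset.sum_congr rfl fun j _ => by rw [integral_const_mul, hm]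
  have hS0 : ∫ ω, S ω ^ 0 ∂P = 1 := by simp
  have hY0 : ∫ ω, Y ω ^ 0 ∂P = 1 := by simp
  refine ⟨fun n => ?_, ?_, ?_, ?_, ?_⟩
  · simp_rw [ex]
    exact integrable_finsetSum _ fun j _ => (hi j (n - j)).const_mul _
  · have := hsum 1
    simpa [Finset.sum_range_succ, hS0, hY0, h.mean, h'.mean] using this
  · rw [hsum]
    simp [Finset.sum_range_succ, h.mean, h'.mean, h.two, h'.two]
    ring
  · rw [hsum]
    simp [Finset.sum_range_succ, h.mean, h'.mean, h.two, h'.two, h.three, h'.three]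
    ring
  · rw [hsum]
    simp [Finset.sum_range_succ, h.mean, h'.mean, h.two, h'.two, h.three, h'.three,
      h.four, h'.four]
    norm_num [Nat.choose]
    ring

end HasCenteredMoments
end Moments

section GaussianMoments

variable {Ω H ι : Type*} [MeasurableSpace Ω] [NormedAddCommGroup H] [InnerProductSpace ℝ H]
  {P : Measure Ω} {X : H → Ω → ℝ} {e : ι → H}

variable (hX : IsIsonormal X P)
include hX

lemma IsIsonormal.integrable_pow (h : H) (n : ℕ) : Integrable (fun ω => X h ω ^ n) P := by
  have := hX.gaussian.isProbabilityMeasure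
  have := (hX.memLp_polynomial (Polynomial.X ^ n) h (r := 1) (by simp)).integrable le_rfl
  simpa using this

lemma IsIsonormal.integral_pow_add_two {h : H} (hh : ‖h‖ = 1) (n : ℕ) :
    ∫ ω, X h ω ^ (n + 2) ∂P = (n + 1) * ∫ ω, X h ω ^ n ∂P := by
  have := hX.integral_mul_polynomial hh h (Polynomial.X ^ (n + 1)) 1
  simp only [Polynomial.eval_pow, Polynomial.eval_X, Polynomial.eval_one, mul_one,
    Polynomial.derivative_X_pow, Polynomial.derivative_one, Polynomial.eval_zero, mul_zero,
    integral_zero, add_zero, Polynomial.eval_mul, Polynomial.eval_C, Nat.add_sub_cancel,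
    integral_const_mul] at this
  rw [show ((n : ℝ) + 1) = ((n + 1 : ℕ) : ℝ) by push_cast; rfl, ← this]
  exact integral_congr_ae (ae_of_all _ fun ω => by ring)

lemma hasCenteredMoments_centeredSq (he : Orthonormal ℝ e) (j : ι) :
    HasCenteredMoments P (centeredSq X e j) 2 8 60 := by
  have := hX.gaussian.isProbabilityMeasure
  have i0 : ∫ ω, X (e j) ω ^ 0 ∂P = 1 := by simp
  have i2 := hX.integral_pow_add_two (he.1 j) 0
  have i4 := hX.integral_pow_add_two (he.1 j) 2
  have i6 := hX.integral_pow_add_two (he.1 j) 4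
  have i8 := hX.integral_pow_add_two (he.1 j) 6
  rw [i0] at i2
  norm_num at i2 i4 i6 i8
  rw [i2] at i4
  rw [i4] at i6
  rw [i6] at i8
  norm_num at i4 i6 i8
  have hi := hX.integrable_pow (e j)
  have ex : ∀ n : ℕ, ∀ ω, centeredSq X e j ω ^ n =
      ∑ i ∈ Finset.range (n + 1), ((-1) ^ (n - i) * n.choose i) * X (e j) ω ^ (2 * i) := by
    intro n ω
    rw [centeredSq, sub_eq_add_neg, add_pow]
    exact Finset.sum_congr rfl fun i _ => by ring
  have hsum : ∀ n : ℕ, ∫ ω, centeredSq X e j ω ^ n ∂P =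
      ∑ i ∈ Finset.range (n + 1),
        ((-1) ^ (n - i) * n.choose i) * ∫ ω, X (e j) ω ^ (2 * i) ∂P := by
    intro n
    simp_rw [ex]
    rw [integral_finsetSum _ fun i _ => (hi (2 * i)).const_mul _]
    exact Finset.sum_congr rfl fun i _ => by rw [integral_const_mul]
  refine ⟨fun n => ?_, hX.integral_sq_sub_one (he.1 j), ?_, ?_, ?_⟩
  · simp_rw [ex]
    exact integrable_finsetSum _ fun i _ => (hi (2 * i)).const_mul _
  all_goals
    rw [hsum]
    norm_num [Finset.sum_range_succ, i2, i4, i6, i8, Nat.choose]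

lemma iIndepFun_of_orthonormal (he : Orthonormal ℝ e) : iIndepFun (fun j => X (e j)) P := by
  have hg : IsGaussianProcess (fun (p : (_ : ι) × Unit) ω => X (e p.1) ω) P :=
    hX.gaussian.comp_right fun p : (_ : ι) × Unit => e p.1
  have h := IsGaussianProcess.iIndepFun_of_covariance_eq_zero
    (X := fun (j : ι) (_ : Unit) => X (e j)) hg
    (fun j _ => hX.gaussian.aemeasurable (e j)) fun i j hij _ _ => by
      rw [hX.covariance_eq, he.2 hij]
  exact h.comp (fun _ x => x ()) fun _ => measurable_pi_apply ()

lemma iIndepFun_centeredSq (he : Orthonormal ℝ e) : iIndepFun (centeredSq X e) P :=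
  (iIndepFun_of_orthonormal hX he).comp (fun _ x => x ^ 2 - 1) fun _ => by fun_prop

lemma hasCenteredMoments_sum (he : Orthonormal ℝ e) (c : ι → ℝ) (s : Finset ι) :
    HasCenteredMoments P (fun ω => ∑ j ∈ s, c j • centeredSq X e j ω) (2 * ∑ j ∈ s, c j ^ 2)
      (8 * ∑ j ∈ s, c j ^ 3) (12 * (∑ j ∈ s, c j ^ 2) ^ 2 + 48 * ∑ j ∈ s, c j ^ 4) := by
  classical
  have := hX.gaussian.isProbabilityMeasure
  have hind : iIndepFun (fun j ω => c j * centeredSq X e j ω) P :=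
    (iIndepFun_centeredSq hX he).comp (fun j x => c j * x) fun _ => by fun_prop
  have hm : ∀ j, AEMeasurable (fun ω => c j * centeredSq X e j ω) P := fun j =>
    (((hX.gaussian.aemeasurable (e j)).pow_const 2).sub_const 1).const_mul (c j)
  induction s using Finset.induction_on with
  | empty =>
    refine ⟨fun n => ?_, ?_, ?_, ?_, ?_⟩ <;> simp
  | insert i s hi ih =>
    have h := hind.indepFun_finsetSum_of_notMem₀ hm hi
    have h1 := ih.add ((hasCenteredMoments_centeredSq hX he i).const_mul (c i)) (by
      convert! h using 1
      ext ω
      simp)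
    convert! h1 using 1
    · ext ω
      rw [Finset.sum_insert hi, add_comm, smul_eq_mul]
    all_goals
      simp only [Finset.sum_insert hi]
      ring

end GaussianMoments

/-! ### Convergence in `L⁴` -/

section FourthMoment

variable {Ω H ι : Type*} [MeasurableSpace Ω] [NormedAddCommGroup H] [InnerProductSpace ℝ H]
  {P : Measure Ω} {X : H → Ω → ℝ} {e : ι → H} {c : ι → ℝ}

instance fact_one_le_four : Fact ((1 : ENNReal) ≤ 4) := ⟨by norm_num⟩

omit [NormedAddCommGroup H] [InnerProductSpace ℝ H] in
lemma norm_toLp_four_pow {g : Ω → ℝ} (hg : MemLp g 4 P) :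
    ‖hg.toLp g‖ ^ 4 = ∫ ω, g ω ^ 4 ∂P := by
  have h0 : 0 ≤ ∫ ω, ‖g ω‖ ^ (4 : ℝ) ∂P := integral_nonneg fun ω => by positivity
  rw [Lp.norm_toLp, hg.eLpNorm_eq_integral_rpow_norm (by norm_num) (by norm_num),
    ENNReal.toReal_ofReal (Real.rpow_nonneg (by simpa using h0) _)]
  simp only [ENNReal.toReal_ofNat] at h0 ⊢
  rw [← Real.rpow_natCast, ← Real.rpow_mul h0]
  norm_num
  refine integral_congr_ae (ae_of_all _ fun ω => ?_)
  exact Even.pow_abs (by decide) _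

variable (hX : IsIsonormal X P) (he : Orthonormal ℝ e)
include hX

lemma memLp_centeredSq (j : ι) {p : ENNReal} (hp : p ≠ ⊤) : MemLp (centeredSq X e j) p P :=
  hX.memLp_sq_sub_one (e j) hp

include he

/-- The hypercontractive bound on the second chaos: the `L⁴` norm of a finite combination of
the `X(e_j)² - 1` is controlled by its `L²` norm. -/
lemma norm_sum_smul_toLp_four_pow_le (s : Finset ι) :
    ‖∑ j ∈ s, c j • (memLp_centeredSq hX j (p := 4) (by simp)).toLp (centeredSq X e j)‖ ^ 4 ≤
      60 * (∑ j ∈ s, c j ^ 2) ^ 2 := by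
  rw [toLp_sum_smul, norm_toLp_four_pow, (hasCenteredMoments_sum hX he c s).four]
  have : ∑ j ∈ s, c j ^ 4 ≤ (∑ j ∈ s, c j ^ 2) ^ 2 := by
    have := Finset.sum_sq_le_sq_sum_of_nonneg (s := s) (f := fun j => c j ^ 2)
      fun j _ => sq_nonneg _
    simpa only [← pow_mul] using this
  linarith

lemma summable_toLp_four (hc : Summable fun j => c j ^ 2) : Summable fun j =>
    c j • (memLp_centeredSq hX j (p := 4) (by simp)).toLp (centeredSq X e j) := by
  rw [summable_iff_vanishing_norm] at hc ⊢
  intro ε hε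
  obtain ⟨s, hs⟩ := hc (ε ^ 2 / 8) (by positivity)
  refine ⟨s, fun t ht => lt_of_pow_lt_pow_left₀ 4 hε.le ?_⟩
  refine (norm_sum_smul_toLp_four_pow_le hX he t).trans_lt ?_
  have h1 := hs t ht
  have h0 : 0 ≤ ∑ j ∈ t, c j ^ 2 := Finset.sum_nonneg fun j _ => sq_nonneg _
  rw [Real.norm_of_nonneg h0] at h1
  have h2 : (∑ j ∈ t, c j ^ 2) ^ 2 ≤ (ε ^ 2 / 8) ^ 2 := by gcongr
  have h3 : 0 < ε ^ 4 := by positivity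
  nlinarith

/-- Expansions on the second chaos converge in `L⁴`. -/
lemma IsQuadratic.hasLpSum_four [CompleteSpace H] {Y : Ω → ℝ} (hY : IsQuadratic X P e c 0 Y) :
    HasLpSum 4 P (centeredSq X e) c Y := by
  have := hX.gaussian.isProbabilityMeasure
  have hw := isOrthogonalL2_centeredSq hX he
  have hY' : HasLpSum 2 P (centeredSq X e) c Y := by simpa [IsQuadratic] using hY
  have h4 : ∀ j, MemLp (centeredSq X e j) 4 P := fun j => memLp_centeredSq hX j (by simp)
  have hc : Summable fun j => c j ^ 2 :=
    hw.summable_iff.1 ((hasLpSum_iff hw.memLp hY'.1).1 hY').summable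
  obtain ⟨Z, hZ⟩ := exists_hasLpSum_of_summable h4 (summable_toLp_four hX he hc)
  have hZ2 : HasLpSum 2 P (centeredSq X e) c Z := by
    refine ⟨hZ.1.mono_exponent (by norm_num), tendsto_of_tendsto_of_tendsto_of_le_of_le
      tendsto_const_nhds hZ.2 (fun _ => zero_le) fun s => ?_⟩
    exact eLpNorm_le_eLpNorm_of_exponent_le (by norm_num)
      (hZ.1.sub (memLp_finsetSum s fun j _ => (h4 j).const_smul (c j))).1
  exact hZ.congr (hZ2.unique hw.memLp hY')

/-- `𝔼[(Y - 3)⁴] = 12 A² + 60 A + 81 + 48 ∑ c_j² (c_j - 1)²` for `Y = ∑ c_j (X(e_j)² - 1)` and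
`A = ∑ c_j²`. The shift by `3` is what makes the third moment `8 ∑ c_j³` and the fourth moment
`12 A² + 48 ∑ c_j⁴` combine into the squares `c_j² (c_j - 1)²`. -/
lemma IsQuadratic.hasSum_fourth_moment [CompleteSpace H] {Y : Ω → ℝ}
    (hY : IsQuadratic X P e c 0 Y) :
    HasSum (fun j => 48 * (c j ^ 2 * (c j - 1) ^ 2))
      (∫ ω, (Y ω - 3) ^ 4 ∂P - (12 * (∑' j, c j ^ 2) ^ 2 + 60 * ∑' j, c j ^ 2 + 81)) := by
  have := hX.gaussian.isProbabilityMeasure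
  have hw := isOrthogonalL2_centeredSq hX he
  have h4 : ∀ j, MemLp (centeredSq X e j) 4 P := fun j => memLp_centeredSq hX j (by simp)
  have hY4 := hY.hasLpSum_four hX he
  have hY' : HasLpSum 2 P (centeredSq X e) c Y := by simpa [IsQuadratic] using hY
  have hc : Summable fun j => c j ^ 2 :=
    hw.summable_iff.1 ((hasLpSum_iff hw.memLp hY'.1).1 hY').summable
  have h3 : MemLp (fun _ : Ω => (3 : ℝ)) 4 P := memLp_const 3
  have t := ((((hasLpSum_iff h4 hY4.1).1 hY4).sub_const (h3.toLp _)).norm).pow 4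
  rw [← MemLp.toLp_sub, norm_toLp_four_pow] at t
  have hs : ∀ s : Finset ι, ‖∑ j ∈ s, c j • (h4 j).toLp (centeredSq X e j) - h3.toLp _‖ ^ 4 =
      12 * (∑ j ∈ s, c j ^ 2) ^ 2 + 60 * ∑ j ∈ s, c j ^ 2 + 81 +
        ∑ j ∈ s, 48 * (c j ^ 2 * (c j - 1) ^ 2) := by
    intro s
    have hm := hasCenteredMoments_sum hX he c s
    rw [toLp_sum_smul, ← MemLp.toLp_sub, norm_toLp_four_pow]
    set S : Ω → ℝ := fun ω => ∑ j ∈ s, c j • centeredSq X e j ω with hS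
    have i1 : Integrable S P := by simpa using hm.integrable 1
    have ex : ∀ ω, (S ω - 3) ^ 4 =
        S ω ^ 4 - 12 * S ω ^ 3 + 54 * S ω ^ 2 - 108 * S ω + 81 := fun ω => by ring
    simp_rw [Pi.sub_apply, ex]
    have j4 := hm.integrable 4
    have j3 := (hm.integrable 3).const_mul 12
    have j2 := (hm.integrable 2).const_mul 54
    have j1 := i1.const_mul 108
    have j43 : Integrable (fun ω => S ω ^ 4 - 12 * S ω ^ 3) P := j4.sub j3
    have j42 : Integrable (fun ω => S ω ^ 4 - 12 * S ω ^ 3 + 54 * S ω ^ 2) P := j43.add j2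
    have j41 : Integrable (fun ω => S ω ^ 4 - 12 * S ω ^ 3 + 54 * S ω ^ 2 - 108 * S ω) P :=
      j42.sub j1
    rw [integral_add j41 (integrable_const _), integral_sub j42 j1, integral_add j43 j2,
      integral_sub j4 j3,
      integral_const_mul, integral_const_mul, integral_const_mul, hm.four, hm.three, hm.two,
      hm.mean]
    have : ∑ j ∈ s, 48 * (c j ^ 2 * (c j - 1) ^ 2) =
        48 * ∑ j ∈ s, c j ^ 4 - 96 * ∑ j ∈ s, c j ^ 3 + 48 * ∑ j ∈ s, c j ^ 2 := by
      simp only [Finset.mul_sum, ← Finset.sum_sub_distrib, ← Finset.sum_add_distrib]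
      exact Finset.sum_congr rfl fun j _ => by ring
    rw [this]
    simp
    ring
  simp_rw [hs] at t
  have hA := hc.hasSum
  have hA' : Tendsto (fun s : Finset ι => ∑ j ∈ s, c j ^ 2) atTop (𝓝 (∑' j, c j ^ 2)) := hA
  have t2 := t.sub ((((hA'.pow 2).const_mul 12).add (hA'.const_mul 60)).add_const 81)
  refine Tendsto.congr (fun s => ?_) t2
  ring

end FourthMoment

/-! ### The Gamma law -/

section Gamma

variable {a : ℝ}

lemma integral_gammaMeasure {E : Type*} [NormedAddCommGroup E] [NormedSpace ℝ E] (ha : 0 < a)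
    (f : ℝ → E) : ∫ x, f x ∂gammaMeasure a 1 =
      ∫ x in Set.Ioi 0, ((Real.Gamma a)⁻¹ * (x ^ (a - 1) * Real.exp (-x))) • f x := by
  have hmeas : Measurable (gammaPDF a 1) := (measurable_gammaPDFReal a 1).ennreal_ofReal
  rw [gammaMeasure, integral_withDensity_eq_integral_toReal_smul hmeas
    (ae_of_all _ fun _ => ENNReal.ofReal_lt_top), ← integral_Ici_eq_integral_Ioi,
    ← integral_indicator measurableSet_Ici]
  refine integral_congr_ae (ae_of_all _ fun x => ?_)
  beta_reduce
  rw [gammaPDF, ENNReal.toReal_ofReal (gammaPDFReal_nonneg ha one_pos x)]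
  simp only [Set.indicator, Set.mem_Ici, gammaPDFReal, Real.one_rpow, one_mul, one_div]
  split_ifs
  · rw [mul_assoc]
  · rw [zero_smul]

lemma integral_pow_gammaMeasure (ha : 0 < a) (n : ℕ) :
    ∫ x, x ^ n ∂gammaMeasure a 1 = Real.Gamma (a + n) / Real.Gamma a := by
  have h := Real.integral_rpow_mul_exp_neg_mul_Ioi (a := a + n) (r := 1) (by positivity) one_pos
  simp only [div_one, Real.one_rpow, one_mul] at h
  rw [integral_gammaMeasure ha, ← h, div_eq_inv_mul, ← integral_const_mul]
  refine setIntegral_congr_fun measurableSet_Ioi fun x (hx : 0 < x) => ?_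
  simp only [smul_eq_mul]
  rw [show a + n - 1 = (a - 1) + n by ring, Real.rpow_add hx, Real.rpow_natCast]
  ring

lemma integrable_pow_gammaMeasure (ha : 0 < a) (n : ℕ) :
    Integrable (fun x : ℝ => x ^ n) (gammaMeasure a 1) := by
  refine .of_integral_ne_zero ?_
  rw [integral_pow_gammaMeasure ha]
  have := Real.Gamma_pos_of_pos ha
  have : 0 < Real.Gamma (a + n) := Real.Gamma_pos_of_pos (by positivity)
  positivity

lemma mgf_gammaMeasure (ha : 0 < a) {t : ℝ} (ht : t < 1) :
    mgf id (gammaMeasure a 1) t = (1 / (1 - t)) ^ a := by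
  have h := Real.integral_rpow_mul_exp_neg_mul_Ioi (a := a) (r := 1 - t) ha (by linarith)
  have hΓ := (Real.Gamma_pos_of_pos ha).ne'
  rw [mgf, integral_gammaMeasure ha]
  rw [← mul_left_inj' hΓ, ← h, mul_comm, ← integral_const_mul]
  refine setIntegral_congr_fun measurableSet_Ioi fun x _ => ?_
  simp only [smul_eq_mul, id]
  rw [show -((1 - t) * x) = -x + t * x by ring, Real.exp_add]
  field_simp

lemma Iio_subset_integrableExpSet_gammaMeasure (ha : 0 < a) :
    Set.Iio 1 ⊆ interior (integrableExpSet id (gammaMeasure a 1)) := by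
  refine interior_maximal (fun t (ht : t < 1) => ?_) isOpen_Iio
  refine Integrable.of_integral_ne_zero ?_
  have := mgf_gammaMeasure ha ht
  rw [mgf] at this
  rw [this]
  have : 0 < 1 - t := by linarith
  positivity

/-- The Laplace transform of the Gamma law on a half plane, by analytic continuation from the
real axis. -/
lemma complexMGF_gammaMeasure (ha : 0 < a) {z : ℂ} (hz : z.re < 1) :
    complexMGF id (gammaMeasure a 1) z = (1 - z) ^ (-(a : ℂ)) := by
  have h1 : AnalyticOnNhd ℂ (complexMGF id (gammaMeasure a 1)) {z | z.re < 1} :=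
    analyticOnNhd_complexMGF.mono fun z hz => Iio_subset_integrableExpSet_gammaMeasure ha hz
  have h2 : AnalyticOnNhd ℂ (fun z : ℂ => (1 - z) ^ (-(a : ℂ))) {z | z.re < 1} := fun z hz =>
    (analyticAt_const.sub analyticAt_id).cpow analyticAt_const
      (Or.inl (by simpa using hz))
  refine h1.eqOn_of_preconnected_of_frequently_eq h2 (z₀ := 0)
    (convex_halfSpace_re_lt 1).isPreconnected (by simp) ?_ hz
  have hx : Tendsto (fun n : ℕ => ((-(1 / ((n : ℝ) + 1)) : ℝ) : ℂ)) atTop (𝓝[≠] 0) := by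
    rw [tendsto_nhdsWithin_iff]
    constructor
    · have := (tendsto_one_div_add_atTop_nhds_zero_nat (𝕜 := ℝ)).neg
      rw [neg_zero] at this
      exact_mod_cast (Complex.continuous_ofReal.tendsto 0).comp this
    · refine Eventually.of_forall fun n => ?_
      simp only [Set.mem_compl_iff, Set.mem_singleton_iff, Complex.ofReal_eq_zero, neg_eq_zero]
      positivity
  refine hx.frequently (Frequently.of_forall fun n => ?_)
  have hn : 0 < 1 / ((n : ℝ) + 1) := by positivity
  rw [complexMGF_ofReal, mgf_gammaMeasure ha (by linarith)]
  have h0 : 0 ≤ 1 - -(1 / ((n : ℝ) + 1)) := by linarith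
  rw [one_div, Real.inv_rpow h0, ← Real.rpow_neg h0, Complex.ofReal_cpow h0]
  push_cast
  rfl

lemma charFun_centeredGamma {ν : ℝ} (hν : 0 < ν) (t : ℝ) :
    charFun (centeredGamma ν) t =
      Complex.exp (-(ν * t * Complex.I)) * (1 - 2 * t * Complex.I) ^ (-(ν / 2 : ℂ)) := by
  have h := complexMGF_gammaMeasure (a := ν / 2) (by positivity) (z := 2 * t * Complex.I)
    (by simp)
  rw [charFun_apply_real, centeredGamma, integral_map (by fun_prop) (by fun_prop)]
  push_cast at h
  rw [← h, complexMGF, ← integral_const_mul]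
  refine integral_congr_ae (ae_of_all _ fun x => ?_)
  simp only [id, ← Complex.exp_add]
  push_cast
  congr 1
  ring

lemma isProbabilityMeasure_centeredGamma {ν : ℝ} (hν : 0 < ν) :
    IsProbabilityMeasure (centeredGamma ν) := by
  have := isProbabilityMeasure_gammaMeasure (a := ν / 2) (r := 1) (by positivity) one_pos
  exact Measure.isProbabilityMeasure_map (by fun_prop)

lemma integral_fourth_centeredGamma {ν : ℝ} (hν : 0 < ν) :
    ∫ x, (x - 3) ^ 4 ∂centeredGamma ν = 12 * ν ^ 2 + 60 * ν + 81 := by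
  have ha : 0 < ν / 2 := by positivity
  rw [centeredGamma, integral_map (by fun_prop) (by fun_prop)]
  have ex : ∀ x : ℝ, (2 * x - ν - 3) ^ 4 = ∑ i ∈ Finset.range 5,
      (2 ^ i * (-(ν + 3)) ^ (4 - i) * (4 : ℕ).choose i) * x ^ i := by
    intro x
    rw [show 2 * x - ν - 3 = 2 * x + (-(ν + 3)) by ring, add_pow]
    exact Finset.sum_congr rfl fun i _ => by ring
  simp_rw [ex]
  rw [integral_finsetSum _ fun i _ => (integrable_pow_gammaMeasure ha i).const_mul _]
  simp_rw [integral_const_mul, integral_pow_gammaMeasure ha]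
  have hΓ := (Real.Gamma_pos_of_pos ha).ne'
  have g1 : Real.Gamma (ν / 2 + 1) = ν / 2 * Real.Gamma (ν / 2) := Real.Gamma_add_one ha.ne'
  have g2 : Real.Gamma (ν / 2 + 2) = (ν / 2 + 1) * Real.Gamma (ν / 2 + 1) := by
    rw [← Real.Gamma_add_one (by positivity)]; congr 1; ring
  have g3 : Real.Gamma (ν / 2 + 3) = (ν / 2 + 2) * Real.Gamma (ν / 2 + 2) := by
    rw [← Real.Gamma_add_one (by positivity)]; congr 1; ring
  have g4 : Real.Gamma (ν / 2 + 4) = (ν / 2 + 3) * Real.Gamma (ν / 2 + 3) := by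
    rw [← Real.Gamma_add_one (by positivity)]; congr 1; ring
  rw [g1] at g2
  rw [g2] at g3
  rw [g3] at g4
  norm_num [Finset.sum_range_succ, g1, g2, g3, g4, Nat.choose]
  field_simp
  ring

end Gamma

/-! ### Sums of independent centered squares -/

section ChiSquare

variable {Ω H ι : Type*} [MeasurableSpace Ω] [NormedAddCommGroup H] [InnerProductSpace ℝ H]
  {P : Measure Ω} {X : H → Ω → ℝ} {e : ι → H}

variable (hX : IsIsonormal X P) (he : Orthonormal ℝ e)
include hX he

lemma charFun_centeredSq (j : ι) (t : ℝ) :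
    charFun (P.map (centeredSq X e j)) t =
      Complex.exp (-(t * Complex.I)) * (1 - 2 * t * Complex.I) ^ (-(1 / 2 : ℂ)) := by
  have hm := hX.gaussian.aemeasurable (e j)
  have hm' : AEMeasurable (centeredSq X e j) P := (hm.pow_const 2).sub_const 1
  have h1 : ∫ ω, Complex.exp (t * centeredSq X e j ω * Complex.I) ∂P =
      ∫ x, Complex.exp (t * ((x ^ 2 - 1 : ℝ) : ℂ) * Complex.I) ∂gaussianReal 0 1 := by
    rw [← hX.map_eq_gaussianReal (he.1 j), integral_map hm (by fun_prop)]
    rfl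
  have h2 := integral_gaussian_complex (b := 1 / 2 - t * Complex.I) (by simp)
  rw [charFun_apply_real, integral_map hm' (by fun_prop), h1,
    integral_gaussianReal_eq_integral_smul one_ne_zero]
  have h3 : ∀ x : ℝ, gaussianPDFReal 0 1 x •
      Complex.exp (t * ((x ^ 2 - 1 : ℝ) : ℂ) * Complex.I) =
      (((√(2 * Real.pi))⁻¹ : ℝ) * Complex.exp (-(t * Complex.I))) *
        Complex.exp (-(1 / 2 - t * Complex.I) * (x : ℂ) ^ 2) := by
    intro x
    rw [gaussianPDFReal, Complex.real_smul]
    push_cast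
    simp only [mul_one, mul_assoc _ (Complex.exp _), ← Complex.exp_add]
    congr 2
    ring
  simp_rw [h3]
  rw [integral_const_mul, h2]
  have hw : (1 - 2 * t * Complex.I : ℂ) ≠ 0 := fun h => by simpa using congrArg Complex.re h
  have harg : (1 - 2 * t * Complex.I : ℂ).arg ≠ Real.pi := fun h => by
    have := (Complex.arg_eq_pi_iff.1 h).1
    norm_num at this
  have h4 : (Real.pi : ℂ) / (1 / 2 - t * Complex.I) =
      ((2 * Real.pi : ℝ) : ℂ) * (1 - 2 * t * Complex.I)⁻¹ := by
    have : (1 / 2 - t * Complex.I : ℂ) = (1 - 2 * t * Complex.I) / 2 := by ring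
    rw [this]
    push_cast
    field_simp
  have hpi : 0 < 2 * Real.pi := by positivity
  have h5 : ((2 * Real.pi : ℝ) : ℂ) ^ (1 / 2 : ℂ) = (√(2 * Real.pi) : ℝ) := by
    rw [Real.sqrt_eq_rpow, Complex.ofReal_cpow hpi.le]
    norm_num
  have h6 : (Real.pi / (1 / 2 - t * Complex.I) : ℂ) ^ (1 / 2 : ℂ) =
      (√(2 * Real.pi) : ℝ) * (1 - 2 * t * Complex.I) ^ (-(1 / 2 : ℂ)) := by
    rw [h4, Complex.cpow_neg, ← Complex.inv_cpow _ _ harg, ← h5,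
      Complex.cpow_def_of_ne_zero (mul_ne_zero (by exact_mod_cast hpi.ne') (inv_ne_zero hw)),
      Complex.log_ofReal_mul hpi (inv_ne_zero hw), add_mul, Complex.exp_add,
      Complex.cpow_def_of_ne_zero (by exact_mod_cast hpi.ne'), Complex.ofReal_log hpi.le,
      Complex.cpow_def_of_ne_zero (inv_ne_zero hw)]
  have h7 : ((√(2 * Real.pi) : ℝ) : ℂ) ≠ 0 := by
    exact_mod_cast (Real.sqrt_pos.2 hpi).ne'
  rw [h6, Complex.ofReal_inv]
  field_simp

/-- A sum of `k` independent centered squares has the centered Gamma law with parameter `k`. -/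
lemma hasLaw_sum_centeredSq {s : Finset ι} (hs : s.Nonempty) :
    HasLaw (fun ω => ∑ j ∈ s, centeredSq X e j ω) (centeredGamma s.card) P := by
  have := hX.gaussian.isProbabilityMeasure
  have hcard : 0 < (s.card : ℝ) := by exact_mod_cast hs.card_pos
  have := isProbabilityMeasure_centeredGamma hcard
  have hm : ∀ j, AEMeasurable (centeredSq X e j) P := fun j =>
    ((hX.gaussian.aemeasurable (e j)).pow_const 2).sub_const 1
  have hms : AEMeasurable (fun ω => ∑ j ∈ s, centeredSq X e j ω) P :=
    Finset.aemeasurable_fun_sum s fun j _ => hm j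
  refine ⟨hms, ?_⟩
  have := Measure.isProbabilityMeasure_map hms
  refine Measure.ext_of_charFun ?_
  ext t
  rw [iIndepFun.charFun_map_fun_finsetSum_eq_prod (fun j _ => hm j)
    ((iIndepFun_centeredSq hX he).restrict s), Finset.prod_apply,
    Finset.prod_congr rfl fun j _ => charFun_centeredSq hX he j t, Finset.prod_const,
    charFun_centeredGamma hcard, mul_pow, ← Complex.exp_nat_mul, ← Complex.cpow_nat_mul]
  push_cast
  congr 2 <;> ring

end ChiSquare

/-! ### The Gamma operators in diagonal coordinates -/

section Diagonal

variable {Ω H ι : Type*} [MeasurableSpace Ω] [NormedAddCommGroup H] [InnerProductSpace ℝ H]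
  {P : Measure Ω} {X : H → Ω → ℝ} {e : ι → H} {c : ι → ℝ}

variable (hX : IsIsonormal X P) (he : Orthonormal ℝ e)
include hX he

/-- The double integral of `∑ c_j e_j ⊗ e_j` is `∑ c_j (X(e_j)² - 1)`. -/
lemma IsDoubleIntegral.isQuadratic {f : HilbertTensorSq H} {F : Ω → ℝ}
    (hF : IsDoubleIntegral X P f F) (hf : HasSum (fun j => c j • tensorL (e j) (e j)) f) :
    IsQuadratic X P e c 0 F := by
  have hw := isOrthogonalL2_centeredSq hX he
  obtain ⟨hF2, hFm⟩ := hF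
  have hmem : ∀ s : Finset ι, (∑ j ∈ s, c j • tensorL (e j) (e j),
      ∑ j ∈ s, c j • (hw.memLp j).toLp (centeredSq X e j)) ∈ doubleIntegralGraph X P := by
    intro s
    have h1 : ∑ j ∈ s, c j • (tensorL (e j) (e j), (hw.memLp j).toLp (centeredSq X e j)) ∈
        doubleIntegralGraph X P := by
      refine Submodule.sum_mem _ fun j _ => Submodule.smul_mem _ _ ?_
      refine Submodule.le_topologicalClosure _ (Submodule.subset_span ⟨e j, he.1 j, rfl, ?_⟩)
      filter_upwards [(hw.memLp j).coeFn_toLp] with ω hω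
      rw [hω, aeval_hermite_two, centeredSq]
    convert! h1 using 1
    ext1 <;> simp [Prod.fst_sum, Prod.snd_sum]
  have hsum : HasSum (fun j => c j • (hw.memLp j).toLp (centeredSq X e j)) (hF2.toLp F) := by
    rw [HasSum, tendsto_iff_norm_sub_tendsto_zero] at hf ⊢
    -- `I₂` is `√2` times an isometry.
    have hn : ∀ s : Finset ι,
        ‖∑ j ∈ s, c j • (hw.memLp j).toLp (centeredSq X e j) - hF2.toLp F‖ =
          √2 * ‖∑ j ∈ s, c j • tensorL (e j) (e j) - f‖ := by
      intro s
      have hd := Submodule.sub_mem _ (hmem s) hFm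
      have := inner_doubleIntegralGraph hX hd hd
      simp only [Prod.mk_sub_mk, real_inner_self_eq_norm_sq] at this
      rw [← Real.sqrt_sq (norm_nonneg (_ - hF2.toLp F)), this, Real.sqrt_mul (by norm_num),
        Real.sqrt_sq (norm_nonneg _)]
    simp_rw [hn]
    simpa using hf.const_mul √2
  simpa [IsQuadratic] using (hasLpSum_iff hw.memLp hF2).2 hsum

lemma IsQuadratic.summable_sq [CompleteSpace H] {k : ℝ} {Y : Ω → ℝ}
    (hY : IsQuadratic X P e c k Y) : Summable fun j => c j ^ 2 :=
  have hw := isOrthogonalL2_centeredSq hX he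
  hw.summable_iff.1 ((hasLpSum_iff hw.memLp hY.1).1 hY).summable

lemma IsQuadratic.exists_derivative [Countable ι] [CompleteSpace H] {k : ℝ} {Y : Ω → ℝ}
    (hY : IsQuadratic X P e c k Y) :
    ∃ U, IsMalliavinDerivative X P Y U ∧
      HasLpSum 2 P (gaussianVec X e) (fun j => 2 * c j) U := by
  have hc : Summable fun j => (2 * c j) ^ 2 := by
    simpa only [mul_pow] using (hY.summable_sq hX he).mul_left (2 ^ 2)
  obtain ⟨U, hU⟩ := (isOrthogonalL2_gaussianVec hX he).exists_hasLpSum hc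
  exact ⟨U, hY.isMalliavinDerivative hX hU, hU⟩

variable {f : HilbertTensorSq H} {F : Ω → ℝ} [Countable ι] [CompleteSpace H]
  [TopologicalSpace.SeparableSpace H]

lemma malliavinD_pseudoInverse (hF : IsDoubleIntegral X P f F) (hq : IsQuadratic X P e c 0 F) :
    MemD12 X P (pseudoInverse X P F) ∧
      HasLpSum 2 P (gaussianVec X e) c (fun ω => -(malliavinD X P (pseudoInverse X P F) ω)) := by
  have hw := isOrthogonalL2_centeredSq hX he
  have hv := isOrthogonalL2_gaussianVec hX he
  have h1 : IsQuadratic X P e (fun j => -(1 / 2) * c j) 0 (fun ω => -(1 / 2) * F ω) := by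
    have := HasLpSum.const_smul hw.memLp hq (-(1 / 2))
    refine this.congr (ae_of_all _ fun ω => ?_)
    simp
  obtain ⟨U, hU, hUs⟩ := h1.exists_derivative hX he
  obtain ⟨hm, hD⟩ := hU.malliavinD_ae_eq hX (pseudoInverse_doubleIntegral hX hF)
  refine ⟨hm, ?_⟩
  have h2 := (hUs.const_smul hv.memLp (-1)).congr (Y' := fun ω =>
    -(malliavinD X P (pseudoInverse X P F) ω)) (by
      filter_upwards [hD] with ω hω
      rw [hω]
      simp)
  convert! h2 using 2 with j
  ring

/-- In coordinates diagonalizing `f`, the Gamma operators act by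
`Γ_r(F) = const + ∑ 2^r c_j^{r+1} (X(e_j)² - 1)`. -/
lemma exists_isQuadratic_gammaOp (hF : IsDoubleIntegral X P f F)
    (hq : IsQuadratic X P e c 0 F) (r : ℕ) :
    ∃ k, IsQuadratic X P e (fun j => 2 ^ r * c j ^ (r + 1)) k (gammaOp X P F r) := by
  induction r with
  | zero => exact ⟨0, by simpa [gammaOp] using hq⟩
  | succ r ih =>
    obtain ⟨k, hk⟩ := ih
    obtain ⟨U, hU, hUs⟩ := hk.exists_derivative hX he
    obtain ⟨-, hD⟩ := hU.malliavinD_ae_eq hX EventuallyEq.rfl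
    have h := isQuadratic_inner hX he (hUs.congr hD.symm)
      (malliavinD_pseudoInverse hX he hF hq).2
    have hcoef : (fun j => 2 * (2 ^ r * c j ^ (r + 1)) * c j) =
        fun j => 2 ^ (r + 1) * c j ^ (r + 1 + 1) := by
      ext j
      ring
    rw [hcoef] at h
    exact ⟨_, h⟩

lemma memD12_gammaOp (hF : IsDoubleIntegral X P f F) (hq : IsQuadratic X P e c 0 F) (r : ℕ) :
    MemD12 X P (gammaOp X P F r) := by
  obtain ⟨k, hk⟩ := exists_isQuadratic_gammaOp hX he hF hq r
  obtain ⟨U, hU, -⟩ := hk.exists_derivative hX he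
  exact ⟨U, hU⟩

/-- `Δ_r(F) = 2 ∑ (2^{r+1} c_j^{r+1} (c_j - 1))²`. -/
lemma hasSum_gammaDelta (hF : IsDoubleIntegral X P f F) (hq : IsQuadratic X P e c 0 F) (r : ℕ) :
    HasSum (fun j => 2 * (2 ^ (r + 1) * c j ^ (r + 1) * (c j - 1)) ^ 2)
      (gammaDelta X P F r) := by
  have hw := isOrthogonalL2_centeredSq hX he
  obtain ⟨k, hk⟩ := exists_isQuadratic_gammaOp hX he hF hq r
  obtain ⟨k', hk'⟩ := exists_isQuadratic_gammaOp hX he hF hq (r + 1)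
  have h : IsQuadratic X P e (fun j => 2 ^ (r + 1) * c j ^ (r + 1) * (c j - 1)) (k' - 2 * k)
      (fun ω => gammaOp X P F (r + 1) ω - 2 * gammaOp X P F r ω) := by
    have := HasLpSum.sub hw.memLp hk' (HasLpSum.const_smul hw.memLp hk 2)
    have h' := this.congr (Y' := fun ω =>
        gammaOp X P F (r + 1) ω - 2 * gammaOp X P F r ω - (k' - 2 * k)) (ae_of_all _ fun ω => by
      simp only [Pi.sub_apply, Pi.smul_apply, smul_eq_mul]
      ring)
    unfold IsQuadratic
    convert! h' using 2 with j
    ring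
  rw [gammaDelta, h.variance_eq hX he]
  exact (h.summable_sq hX he).hasSum.mul_left 2

lemma gammaDelta_eq_zero_iff (hF : IsDoubleIntegral X P f F) (hq : IsQuadratic X P e c 0 F)
    (r : ℕ) : gammaDelta X P F r = 0 ↔ ∀ j, c j = 0 ∨ c j = 1 := by
  have h := hasSum_gammaDelta hX he hF hq r
  constructor
  · intro h0 j
    rw [h0, hasSum_zero_iff_of_nonneg fun j => by positivity] at h
    have hj := congrFun h j
    simpa [sub_eq_zero] using hj
  · intro hc
    refine h.unique ?_
    convert! hasSum_zero with j
    rcases hc j with h | h <;> simp [h]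

lemma gammaDelta_succ_le (hF : IsDoubleIntegral X P f F) (hq : IsQuadratic X P e c 0 F)
    (r : ℕ) : gammaDelta X P F (r + 1) ≤ 4 * (∑' j, c j ^ 2) * gammaDelta X P F r := by
  refine hasSum_le (fun j => ?_) (hasSum_gammaDelta hX he hF hq (r + 1))
    ((hasSum_gammaDelta hX he hF hq r).mul_left _)
  have hj : c j ^ 2 ≤ ∑' j, c j ^ 2 :=
    (hq.summable_sq hX he).le_tsum j fun _ _ => sq_nonneg _
  calc 2 * (2 ^ (r + 1 + 1) * c j ^ (r + 1 + 1) * (c j - 1)) ^ 2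
      = 4 * c j ^ 2 * (2 * (2 ^ (r + 1) * c j ^ (r + 1) * (c j - 1)) ^ 2) := by ring
    _ ≤ _ := by gcongr

omit [Countable ι] [TopologicalSpace.SeparableSpace H] in
/-- A second chaos element has a centered Gamma law exactly when its nonzero eigenvalues are
all `1`. -/
lemma IsQuadratic.hasLaw_centeredGamma_iff {ν : ℝ} (hν : 0 < ν) (hq : IsQuadratic X P e c 0 F)
    (hc : ∑' j, c j ^ 2 = ν) :
    HasLaw F (centeredGamma ν) P ↔ ∀ j, c j = 0 ∨ c j = 1 := by
  have hw := isOrthogonalL2_centeredSq hX he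
  constructor
  · intro hlaw j
    have h4 := hq.hasSum_fourth_moment hX he
    have := hlaw.integral_comp (f := fun x => (x - 3) ^ 4) (by fun_prop)
    rw [Function.comp_def, integral_fourth_centeredGamma hν] at this
    rw [this, hc, sub_self, hasSum_zero_iff_of_nonneg fun j => by positivity] at h4
    have hj := congrFun h4 j
    simpa [sub_eq_zero] using hj
  · intro h01
    have hsq : ∀ j, c j ^ 2 = c j := fun j => by rcases h01 j with h | h <;> simp [h]
    have hs := hq.summable_sq hX he
    -- A convergent sum of zeros and ones has finitely many nonzero terms.
    have hfin : (Function.support c).Finite := by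
      have h1 : ∀ᶠ j in cofinite, c j ^ 2 < 1 :=
        hs.tendsto_cofinite_zero.eventually_lt_const one_pos
      refine (eventually_cofinite.1 h1).subset fun j hj => ?_
      rcases h01 j with h | h
      · exact absurd h hj
      · simp [h]
    set s := hfin.toFinset with hsdef
    have hout : ∀ j, j ∉ s → c j = 0 := fun j hj => by simpa [hsdef] using hj
    have hin : ∀ j ∈ s, c j = 1 := fun j hj =>
      (h01 j).resolve_left (by simpa [hsdef] using hj)
    have hcard : ν = s.card := by
      rw [← hc, tsum_eq_sum (s := s) fun j hj => by rw [hsq, hout j hj],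
        Finset.sum_congr rfl fun j hj => by rw [hsq, hin j hj]]
      simp
    have hne : s.Nonempty := by
      rw [← Finset.card_pos]
      rw [hcard] at hν
      exact_mod_cast hν
    have hS : HasLpSum 2 P (centeredSq X e) c (fun ω => ∑ j ∈ s, centeredSq X e j ω) := by
      have hm : MemLp (fun ω => ∑ j ∈ s, centeredSq X e j ω) 2 P :=
        memLp_finsetSum s fun j _ => hw.memLp j
      refine ⟨hm, tendsto_const_nhds.congr' ?_⟩
      filter_upwards [eventually_ge_atTop s] with t ht
      have : (fun ω => ∑ j ∈ s, centeredSq X e j ω) -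
          (fun ω => ∑ j ∈ t, c j • centeredSq X e j ω) = 0 := by
        ext ω
        rw [Pi.sub_apply, ← Finset.sum_subset ht fun j _ hj => by rw [hout j hj, zero_smul],
          ← Finset.sum_sub_distrib]
        exact Finset.sum_eq_zero fun j hj => by rw [hin j hj, one_smul, sub_self]
      rw [this, eLpNorm_zero]
    have hF : HasLpSum 2 P (centeredSq X e) c F := by simpa [IsQuadratic] using hq
    rw [hcard]
    exact (hasLaw_sum_centeredSq hX he hne).congr (hF.unique hw.memLp hS)

end Diagonal

end WienerGamma

theorem mainTheorem5 {Ω H : Type*} [MeasurableSpace Ω]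
    [NormedAddCommGroup H] [InnerProductSpace ℝ H] [CompleteSpace H]
    [TopologicalSpace.SeparableSpace H]
    (P : Measure Ω) [IsProbabilityMeasure P]
    (X : H → Ω → ℝ) (hX : WienerGamma.IsIsonormal X P)
    (ν : ℝ) (hν : 0 < ν)
    (f : WienerGamma.HilbertTensorSq H) (hf : f ∈ WienerGamma.symTensorSq H)
    (F : Ω → ℝ) (hF : WienerGamma.IsDoubleIntegral X P f F)
    (hvar : ∫ ω, F ω ^ 2 ∂P = 2 * ν) :
    (WienerGamma.MemD12 X P (WienerGamma.pseudoInverse X P F) ∧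
      ∀ r : ℕ, WienerGamma.MemD12 X P (WienerGamma.gammaOp X P F r)) ∧
    (HasLaw F (WienerGamma.centeredGamma ν) P ↔
      ∃ r : ℕ, WienerGamma.gammaDelta X P F r = 0) ∧
    (HasLaw F (WienerGamma.centeredGamma ν) P →
      ∀ r : ℕ, WienerGamma.gammaDelta X P F r = 0) ∧
    (∀ r : ℕ, WienerGamma.gammaDelta X P F (r + 1) ≤
      4 * ν * WienerGamma.gammaDelta X P F r) := by
  obtain ⟨ι, hι, e, c, he, hsum⟩ := WienerGamma.exists_diagonalization hf
  have hq := hF.isQuadratic hX he hsum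
  have hν' : ∑' j, c j ^ 2 = ν := by
    have h := (WienerGamma.isOrthogonalL2_centeredSq hX he).integral_norm_sq hq
    simp only [sub_zero, Real.norm_eq_abs, sq_abs] at h
    linarith
  have hlaw := hq.hasLaw_centeredGamma_iff hX he hν hν'
  have hdelta := WienerGamma.gammaDelta_eq_zero_iff hX he hF hq
  refine ⟨⟨(WienerGamma.malliavinD_pseudoInverse hX he hF hq).1,
    WienerGamma.memD12_gammaOp hX he hF hq⟩, ?_, ?_, ?_⟩
  · rw [hlaw]
    exact ⟨fun h => ⟨0, (hdelta 0).2 h⟩, fun ⟨r, hr⟩ => (hdelta r).1 hr⟩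
  · exact fun h r => (hdelta r).2 (hlaw.1 h)
  · rw [← hν']
    exact WienerGamma.gammaDelta_succ_le hX he hF hq
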